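/- **Setting.** Let $R:\mathbb R^{n_y}\times\mathbb R^n\to\mathbb R^m$ and $c:\mathbb R^{n_y}\times\mathbb R^n\to\mathbb R^p$, with $c$ continuously differentiable, and suppose that for every $u$ the equation $c(y,u)=0$ has a unique solution $y(u)$, that the partial Jacobian $c_y$ is invertible at $(y(u),u)$, and that $R$ is differentiable at $(y(u),u)$ with partial Jacobians $G_y,G_u$. Put $\hat R(u)=R(y(u),u)$, $\hat J(u)=\frac12\|\hat R(u)\|^2$ and, with all Jacobians taken at $(y(u),u)$, $\hat G(u)=G_u-G_y\,c_y^{-1}c_u$. Assume that $\hat J$ is continuously differentiable with $L$-Lipschitz gradient, $L>0$. **Algorithm.** Let $\eta\in(0,1)$, $0<\gamma_{\min}\le\gamma_0$, $\theta\in[0,1)$, $u_0\in\mathbb R^n$. At iteration $k$ put $g_k=\hat G(u_k)^{\mathrm T}\hat R(u_k)$ and let $H_k\in\mathbb R^{n\times n}$ be symmetric positive semidefinite with $\|H_k\|\le M_H$, where $M_H>0$. The step $s_k$ is the first iterate of the conjugate gradient method, started at $0$ and applied to $(H_k+\gamma_kI)s=-g_k$, that satisfies $$\|(H_k+\gamma_kI)s_k+g_k\|\le\theta\sqrt{\frac{\gamma_k}{\|H_k\|+\gamma_k}}\,\|g_k\|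 .\qquad(1)$$ Each conjugate gradient iteration costs one matrix-vector product. With $m_k(u_k+s)=\frac12\|\hat R(u_k)\|^2+g_k^{\mathrm T}s+\frac12s^{\mathrm T}(H_k+\gamma_kI)s$, if $$\frac{\hat J(u_k)-\hat J(u_k+s_k)}{m_k(u_k)-m_k(u_k+s_k)}\ge\eta$$ then $u_{k+1}=u_k+s_k$ and $\gamma_{k+1}=\max\{\frac12\gamma_k,\gamma_{\min}\}$; otherwise $u_{k+1}=u_k$ and $\gamma_{k+1}=2\gamma_k$. Iteration $k$ is successful if $u_{k+1}\ne u_k$. For $\epsilon_R>0$ and $\epsilon_g\in(0,1)$, call $u$ an $(\epsilon_R,\epsilon_g)$-point if $\|\hat R(u)\|\le\epsilon_R$ or $\|\hat G(u)^{\mathrm T}\hat R(u)\|/\|\hat R(u)\|\le\epsilon_g$. Let $\mathcal S$ (resp. $\mathcal U$) be the set of successful (resp. unsuccessful) iterations $k$ for which $u_k$ is not an $(\epsilon_R,\epsilon_g)$-point. Put $$\gamma_{\max}^{in}=\max\Big\{1,\gamma_0,\tfrac{L(1+\theta)^2}{(1-\eta)(1-\theta^2)}\Big\},\qquad \kappa=\frac{M_H+\gamma_{\max}^{in}}{\gamma_{\min}},\qquad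 N=\min\Big\{n,\Big\lceil\tfrac12\sqrt\kappa\,\log\tfrac{2\kappa}{\theta}\Big\rceil\Big\},$$ where $N=n$ if $\theta=0$. **Statement.** The sets $\mathcal S$ and $\mathcal U$ are finite and the algorithm reaches an $(\epsilon_R,\epsilon_g)$-point. Until the first such point, conjugate gradient finds a step satisfying (1) within $N$ products at every iteration; the products spent in successful iterations number at most $N\,(1+|\mathcal S|)$, and all matrix-vector products together number at most $$N\,\bigl(1+|\mathcal S|+|\mathcal U|\bigr)=\mathcal O\!\left(\min\Big\{n,\sqrt\kappa\,\log\frac{\kappa}{\theta}\Big\}\,\log\Big(\frac1{1-\theta^2}\Big)\,\frac1{(1-\theta^2)^{2}}\,\log(\epsilon_R^{-1})\,\epsilon_g^{-2}\right).$$ Here $\mathcal O$ means: given $\theta_0,\bar\epsilon\in(0,1)$ and an upper bound $J_0$ on $\hat J(u_0)$, there is a constant depending only on $L,M_H,\eta,\gamma_0,\gamma_{\min},J_0,\theta_0,\bar\epsilon$ (in particular not on the dimensions, the problem, $\theta$, $\epsilon_R$, $\epsilon_g$ or the matrices $H_k$) with which the bound holds for all $\theta\in[\theta_0,1)$, $\epsilon_R\in(0,\bar\epsilon]$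 and $\epsilon_g\in(0,1)$. -/

import Mathlib

open scoped BigOperators

noncomputable section

/-- `ℝᵈ` with the Euclidean norm. -/
abbrev Euc (d : ℕ) : Type := EuclideanSpace ℝ (Fin d)

/-! ### Conjugate gradient -/

section ConjugateGradient

variable {E : Type*} [NormedAddCommGroup E] [InnerProductSpace ℝ E]

/-- State of the conjugate gradient method: iterate, residual, search direction. -/
structure CGState (E : Type*) where
  x : E
  r : E
  d : E

/-- One conjugate gradient iteration for `A x = b`. It uses exactly one product with `A`,
namely `w = A d`. -/
def cgStep (A : E →L[ℝ] E) (z : CGState E) : CGState E :=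
  let w : E := A z.d
  let α : ℝ := ‖z.r‖ ^ 2 / inner ℝ z.d w
  let r' : E := z.r - α • w
  let β : ℝ := ‖r'‖ ^ 2 / ‖z.r‖ ^ 2
  { x := z.x + α • z.d, r := r', d := r' + β • z.d }

/-- The state after `q` iterations, started at `x = 0` (residual and direction equal to `b`). -/
def cgState (A : E →L[ℝ] E) (b : E) : ℕ → CGState E
  | 0 => { x := 0, r := b, d := b }
  | q + 1 => cgStep A (cgState A b q)

/-- The `q`-th conjugate gradient iterate for `A x = b`. -/
def cgIterate (A : E →L[ℝ] E) (b : E) (q : ℕ) : E := (cgState A b q).x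

/-- The inexactness condition on a step `s`, with `t = (H + γ I) s + g`:
`‖t‖ ≤ θ √(γ / (‖H‖ + γ)) ‖g‖`. -/
def IsInexactStep (θ γ : ℝ) (H : E →L[ℝ] E) (g s : E) : Prop :=
  ‖(H + γ • ContinuousLinearMap.id ℝ E) s + g‖ ≤ θ * √(γ / (‖H‖ + γ)) * ‖g‖

/-- Number of conjugate gradient iterations (equivalently, of matrix-vector products) performed
on `(H + γ I) s = -g` until the first iterate that satisfies the inexactness condition. -/
def cgCount (θ γ : ℝ) (H : E →L[ℝ] E) (g : E) : ℕ :=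
  sInf {q : ℕ | IsInexactStep θ γ H g
    (cgIterate (H + γ • ContinuousLinearMap.id ℝ E) (-g) q)}

/-- The step returned by conjugate gradient: its first iterate satisfying the inexactness
condition. -/
def cgInexactStep (θ γ : ℝ) (H : E →L[ℝ] E) (g : E) : E :=
  cgIterate (H + γ • ContinuousLinearMap.id ℝ E) (-g) (cgCount θ γ H g)

end ConjugateGradient

/-! ### Implicitly constrained least squares -/

/-- Data of the problem `min ½ ‖R(y,u)‖²` subject to `c(y,u) = 0`, together with the
solution map `u ↦ y(u)` of the constraint. -/
structure ImplicitLS (ny n m p : ℕ) where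
  R : Euc ny × Euc n → Euc m
  c : Euc ny × Euc n → Euc p
  y : Euc n → Euc ny

namespace ImplicitLS

variable {ny n m p : ℕ} (P : ImplicitLS ny n m p)

/-- Jacobian of `c` with respect to `y` at `(y(u), u)`. -/
def cy (u : Euc n) : Euc ny →L[ℝ] Euc p := fderiv ℝ (fun v => P.c (v, u)) (P.y u)

/-- Jacobian of `c` with respect to `u` at `(y(u), u)`. -/
def cu (u : Euc n) : Euc n →L[ℝ] Euc p := fderiv ℝ (fun w => P.c (P.y u, w)) u

/-- Jacobian of `R` with respect to `y` at `(y(u), u)`. -/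
def Gy (u : Euc n) : Euc ny →L[ℝ] Euc m := fderiv ℝ (fun v => P.R (v, u)) (P.y u)

/-- Jacobian of `R` with respect to `u` at `(y(u), u)`. -/
def Gu (u : Euc n) : Euc n →L[ℝ] Euc m := fderiv ℝ (fun w => P.R (P.y u, w)) u

/-- The standing requirements on the problem: `y(u)` is the unique solution of `c(·,u) = 0`,
`c` is continuously differentiable, `c_y` is invertible on the feasible set, and the Jacobians
of `R` exist there. -/
structure WellPosed : Prop where
  solution : ∀ u v, P.c (v, u) = 0 ↔ v = P.y u
  contDiff_c : ContDiff ℝ 1 P.c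
  invertible_cy : ∀ u, (P.cy u).IsInvertible
  differentiable_R : ∀ u, DifferentiableAt ℝ P.R (P.y u, u)

/-- Reduced residual `R̂(u) = R(y(u),u)`. -/
def Rhat (u : Euc n) : Euc m := P.R (P.y u, u)

/-- Reduced objective `Ĵ(u) = ½ ‖R̂(u)‖²`. -/
def Jhat (u : Euc n) : ℝ := 1 / 2 * ‖P.Rhat u‖ ^ 2

/-- The adjoint formula `Ĝ(u) = G_u - G_y c_y⁻¹ c_u`. -/
def Ghat (u : Euc n) : Euc n →L[ℝ] Euc m :=
  P.Gu u - (P.Gy u).comp ((P.cy u).inverse.comp (P.cu u))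

/-- `Ĝ(u)ᵀ R̂(u)`. -/
def grad (u : Euc n) : Euc n := ContinuousLinearMap.adjoint (P.Ghat u) (P.Rhat u)

/-- `Ĵ` is continuously differentiable and its gradient is `L`-Lipschitz. -/
def LipschitzGradient (L : ℝ) : Prop :=
  ContDiff ℝ 1 P.Jhat ∧
    ∀ v w : Euc n, ‖gradient P.Jhat v - gradient P.Jhat w‖ ≤ L * ‖v - w‖

/-- Approximate stationarity: `‖R̂(u)‖ ≤ ε_R` or `‖Ĝ(u)ᵀR̂(u)‖ / ‖R̂(u)‖ ≤ ε_g`. -/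
def IsEpsPoint (εR εg : ℝ) (u : Euc n) : Prop :=
  ‖P.Rhat u‖ ≤ εR ∨ ‖P.grad u‖ / ‖P.Rhat u‖ ≤ εg

/-- The quadratic model at `u`, as a function of the step `s`. -/
def model (u : Euc n) (H : Euc n →L[ℝ] Euc n) (γ : ℝ) (s : Euc n) : ℝ :=
  1 / 2 * ‖P.Rhat u‖ ^ 2 + inner ℝ (P.grad u) s +
    1 / 2 * inner ℝ s ((H + γ • ContinuousLinearMap.id ℝ (Euc n)) s)

/-- Ratio of actual to predicted decrease. -/
def ratio (u : Euc n) (H : Euc n →L[ℝ] Euc n) (γ : ℝ) (s : Euc n) : ℝ :=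
  (P.Jhat u - P.Jhat (u + s)) / (P.model u H γ 0 - P.model u H γ s)

/-- The step computed by conjugate gradient at `u`, for the matrix `H` and parameter `γ`. -/
def step (θ : ℝ) (u : Euc n) (H : Euc n →L[ℝ] Euc n) (γ : ℝ) : Euc n :=
  cgInexactStep θ γ H (P.grad u)

/-- `(u_k, γ_k)` are the iterates and parameters produced by the regularization method from
`(u₀, γ₀)` with the matrices `H_k`, steps being computed by conjugate gradient. -/
structure IsRun (η θ γmin γ0 : ℝ) (u0 : Euc n) (H : ℕ → (Euc n →L[ℝ] Euc n))
    (u : ℕ → Euc n) (γ : ℕ → ℝ) : Prop where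
  u_zero : u 0 = u0
  γ_zero : γ 0 = γ0
  accept : ∀ k, η ≤ P.ratio (u k) (H k) (γ k) (P.step θ (u k) (H k) (γ k)) →
    u (k + 1) = u k + P.step θ (u k) (H k) (γ k) ∧ γ (k + 1) = max (0.5 * γ k) γmin
  reject : ∀ k, ¬ η ≤ P.ratio (u k) (H k) (γ k) (P.step θ (u k) (H k) (γ k)) →
    u (k + 1) = u k ∧ γ (k + 1) = 2 * γ k

/-- Successful iterations (`u_{k+1} ≠ u_k`) at which `u_k` is not an approximate
stationary point. -/
def successes (εR εg : ℝ) (u : ℕ → Euc n) : Set ℕ :=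
  {k | u (k + 1) ≠ u k ∧ ¬ P.IsEpsPoint εR εg (u k)}

/-- Unsuccessful iterations (`u_{k+1} = u_k`) at which `u_k` is not an approximate
stationary point. -/
def failures (εR εg : ℝ) (u : ℕ → Euc n) : Set ℕ :=
  {k | u (k + 1) = u k ∧ ¬ P.IsEpsPoint εR εg (u k)}

/-- Matrix-vector products spent at iteration `k`. -/
def products (θ : ℝ) (H : ℕ → (Euc n →L[ℝ] Euc n)) (u : ℕ → Euc n) (γ : ℕ → ℝ) (k : ℕ) : ℕ :=
  cgCount θ (γ k) (H k) (P.grad (u k))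

end ImplicitLS

/-- `γ_max^in = max {1, γ₀, L (1+θ)² / ((1-η)(1-θ²))}`. -/
def gammaMaxIn (L η θ γ0 : ℝ) : ℝ :=
  max 1 (max γ0 (L * (1 + θ) ^ 2 / ((1 - η) * (1 - θ ^ 2))))

/-- `κ = (M_H + γ_max^in) / γ_min`. -/
def kappaIn (L MH η θ γ0 γmin : ℝ) : ℝ := (MH + gammaMaxIn L η θ γ0) / γmin

/-- The bound `min {n, ⌈½ √κ log (2κ/θ)⌉}` on the products of one conjugate gradient call
(read as `n` when `θ = 0`, where the second term is infinite). -/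
def cgBound (n : ℕ) (κ θ : ℝ) : ℕ :=
  if θ = 0 then n else min n ⌈1 / 2 * √κ * Real.log (2 * κ / θ)⌉₊

end

/-!
Conjugate gradient iterates satisfy Galerkin orthogonality: the residual is orthogonal to the
Krylov space that contains the iterate. Hence the iterate is optimal in the energy norm, and
comparison with a scaled Chebyshev polynomial shows that `N` products suffice for the inexactness
condition. Orthogonality also turns the inexactness condition into the lower bound
`(1 - θ²) ‖g_k‖² / (2 (‖H_k‖ + γ_k))` for the decrease predicted by the model.

By the implicit function theorem `g_k` is the gradient of `Ĵ`, so by the descent lemma a step with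
`γ_k ≥ L / (1 - η)` is accepted. Thus `γ_k` never exceeds `max {γ₀, 2 L / (1 - η)}` while
`g_k ≠ 0`. Away from `(ε_R, ε_g)`-points `‖g_k‖² ≥ 2 ε_g² Ĵ(u_k)`, so each success multiplies `Ĵ`
by a factor `1 - const · (1 - θ²) ε_g²`, while `Ĵ > ε_R² / 2`: this makes the number of successes
logarithmic in `1 / ε_R`. Each failure is followed by a success after boundedly many doublings
of `γ`.
-/

section Operators

open scoped InnerProductSpace

variable {E : Type*} [NormedAddCommGroup E] [InnerProductSpace ℝ E] {A : E →L[ℝ] E} {a c M : ℝ}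

/-- A symmetric positive definite operator: the class on which conjugate gradient operates. -/
structure IsPositiveDefinite (A : E →L[ℝ] E) : Prop where
  isSymmetric : (A : E →ₗ[ℝ] E).IsSymmetric
  energy_pos : ∀ v, v ≠ 0 → 0 < ⟪v, A v⟫_ℝ

/-- A symmetric operator whose spectrum lies in `[a, c]`, expressed by bounds on its
quadratic form. -/
structure HasSpectralBounds (A : E →L[ℝ] E) (a c : ℝ) : Prop where
  isSymmetric : (A : E →ₗ[ℝ] E).IsSymmetric
  le_energy : ∀ v, a * ‖v‖ ^ 2 ≤ ⟪v, A v⟫_ℝ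
  energy_le : ∀ v, ⟪v, A v⟫_ℝ ≤ c * ‖v‖ ^ 2

namespace IsPositiveDefinite

theorem energy_nonneg (hA : IsPositiveDefinite A) (v : E) : 0 ≤ ⟪v, A v⟫_ℝ := by
  rcases eq_or_ne v 0 with rfl | hv
  · simp
  · exact (hA.energy_pos v hv).le

theorem injective (hA : IsPositiveDefinite A) : Function.Injective A := by
  refine (injective_iff_map_eq_zero A).2 fun v hv => ?_
  by_contra hne
  simpa [hv] using hA.energy_pos v hne

theorem surjective [FiniteDimensional ℝ E] (hA : IsPositiveDefinite A) :
    Function.Surjective A :=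
  LinearMap.surjective_of_injective (f := (A : E →ₗ[ℝ] E)) hA.injective

theorem energy_add (hA : IsPositiveDefinite A) (v w : E) :
    ⟪v + w, A (v + w)⟫_ℝ = ⟪v, A v⟫_ℝ + 2 * ⟪A v, w⟫_ℝ + ⟪w, A w⟫_ℝ := by
  have hsymm : ⟪A v, w⟫_ℝ = ⟪v, A w⟫_ℝ := hA.isSymmetric v w
  rw [map_add, inner_add_left, inner_add_right, inner_add_right, ← hsymm, real_inner_comm (A v) w]
  ring

end IsPositiveDefinite

namespace HasSpectralBounds

theorem mono_right (hA : HasSpectralBounds A a c) {c' : ℝ} (h : c ≤ c') :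
    HasSpectralBounds A a c' where
  isSymmetric := hA.isSymmetric
  le_energy := hA.le_energy
  energy_le v := (hA.energy_le v).trans (by gcongr)

theorem isPositiveDefinite (hA : HasSpectralBounds A a c) (ha : 0 < a) :
    IsPositiveDefinite A where
  isSymmetric := hA.isSymmetric
  energy_pos v hv := lt_of_lt_of_le (by positivity) (hA.le_energy v)

theorem energy_nonneg (hA : HasSpectralBounds A a c) (ha : 0 ≤ a) (v : E) : 0 ≤ ⟪v, A v⟫_ℝ :=
  le_trans (by positivity) (hA.le_energy v)

theorem energy_le_norm_sq_div (hA : HasSpectralBounds A a c) (ha : 0 < a) (v : E) :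
    ⟪v, A v⟫_ℝ ≤ ‖A v‖ ^ 2 / a := by
  rw [le_div_iff₀ ha]
  nlinarith [hA.le_energy v, real_inner_le_norm v (A v), sq_nonneg (a * ‖v‖ - ‖A v‖)]

theorem norm_sq_le_energy (hA : HasSpectralBounds A a c) (ha : 0 ≤ a) (v : E) :
    ‖A v‖ ^ 2 ≤ c * ⟪v, A v⟫_ℝ := by
  have hv := hA.energy_nonneg ha v
  let B : LinearMap.BilinForm ℝ E := (innerₗ E).compl₂ (A : E →ₗ[ℝ] E)
  have hsymm : ⟪v, A (A v)⟫_ℝ = ‖A v‖ ^ 2 := by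
    rw [← real_inner_self_eq_norm_sq]; exact (hA.isSymmetric v (A v)).symm
  have cauchy_schwarz : ‖A v‖ ^ 2 * ‖A v‖ ^ 2 ≤ ⟪v, A v⟫_ℝ * ⟪A v, A (A v)⟫_ℝ := by
    simpa [B, hsymm] using B.apply_mul_apply_le_of_forall_zero_le (hA.energy_nonneg ha) v (A v)
  rcases eq_or_ne (A v) 0 with h | h
  · simp [h]
  · refine le_of_mul_le_mul_right (cauchy_schwarz.trans ?_) (by positivity : 0 < ‖A v‖ ^ 2)
    calc ⟪v, A v⟫_ℝ * ⟪A v, A (A v)⟫_ℝ ≤ ⟪v, A v⟫_ℝ * (c * ‖A v‖ ^ 2) := by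
          gcongr; exact hA.energy_le _
      _ = c * ⟪v, A v⟫_ℝ * ‖A v‖ ^ 2 := by ring

variable [FiniteDimensional ℝ E]

/- The Pythagorean identity in the energy norm for `A⁻¹ (A s + g) = A⁻¹ g + s`. -/
theorem le_energy_of_inner_eq_zero (hA : HasSpectralBounds A a c) (ha : 0 < a) (hc : 0 < c)
    {s g : E} (horth : ⟪A s + g, s⟫_ℝ = 0) :
    ‖g‖ ^ 2 / c - ‖A s + g‖ ^ 2 / a ≤ ⟪s, A s⟫_ℝ := by
  have hpos := hA.isPositiveDefinite ha
  obtain ⟨e, rfl⟩ := hpos.surjective g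
  have horth' : ⟪A s, s⟫_ℝ + ⟪A s, e⟫_ℝ = 0 := by
    have hsymm : ⟪A e, s⟫_ℝ = ⟪e, A s⟫_ℝ := hA.isSymmetric e s
    rw [← horth, inner_add_left, hsymm, real_inner_comm e]
  have pythagoras : ⟪e, A e⟫_ℝ = ⟪s + e, A (s + e)⟫_ℝ + ⟪s, A s⟫_ℝ := by
    rw [hpos.energy_add, real_inner_comm (A s) s]
    linarith
  have hle : ⟪s + e, A (s + e)⟫_ℝ ≤ ‖A s + A e‖ ^ 2 / a := by
    simpa only [map_add] using hA.energy_le_norm_sq_div ha (s + e)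
  have hge : ‖A e‖ ^ 2 / c ≤ ⟪e, A e⟫_ℝ :=
    (div_le_iff₀' hc).2 (hA.norm_sq_le_energy ha.le e)
  linarith

end HasSpectralBounds

theorem isSymmetric_aeval {T : E →ₗ[ℝ] E} (hT : T.IsSymmetric) (p : Polynomial ℝ) :
    (Polynomial.aeval T p).IsSymmetric := by
  induction p using Polynomial.induction_on' with
  | add p q hp hq => rw [map_add]; exact hp.add hq
  | monomial k r =>
    rw [Polynomial.aeval_monomial, ← Algebra.smul_def]
    exact (hT.pow k).smul (conj_trivial r)

variable [FiniteDimensional ℝ E] {T : E →ₗ[ℝ] E}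

theorem repr_eigenvectorBasis_aeval (hT : T.IsSymmetric) (p : Polynomial ℝ) (v : E)
    (i : Fin (Module.finrank ℝ E)) :
    (hT.eigenvectorBasis rfl).repr (Polynomial.aeval T p v) i =
      p.eval (hT.eigenvalues rfl i) * (hT.eigenvectorBasis rfl).repr v i := by
  rw [OrthonormalBasis.repr_apply_apply, OrthonormalBasis.repr_apply_apply,
    ← isSymmetric_aeval hT p,
    Module.End.aeval_apply_of_mem_apply_eq_smul (hT.apply_eigenvectorBasis rfl i),
    RCLike.ofReal_real_eq_id, id_eq, real_inner_smul_left]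

theorem inner_apply_self_eq_sum_eigenvalues (hT : T.IsSymmetric) (v : E) :
    ⟪v, T v⟫_ℝ = ∑ i, hT.eigenvalues rfl i * (hT.eigenvectorBasis rfl).repr v i ^ 2 := by
  rw [← (hT.eigenvectorBasis rfl).repr.inner_map_map, PiLp.inner_apply]
  refine Finset.sum_congr rfl fun i _ => ?_
  rw [hT.eigenvectorBasis_apply_self_apply]
  simp only [RCLike.ofReal_real_eq_id, id_eq, RCLike.inner_apply, conj_trivial]
  ring

namespace HasSpectralBounds

theorem eigenvalues_mem_Icc (hA : HasSpectralBounds A a c) (i : Fin (Module.finrank ℝ E)) :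
    hA.isSymmetric.eigenvalues rfl i ∈ Set.Icc a c := by
  have hlow := hA.le_energy (hA.isSymmetric.eigenvectorBasis rfl i)
  have hup := hA.energy_le (hA.isSymmetric.eigenvectorBasis rfl i)
  have hAi : A (hA.isSymmetric.eigenvectorBasis rfl i) = _ :=
    hA.isSymmetric.apply_eigenvectorBasis rfl i
  rw [hAi, inner_smul_right, real_inner_self_eq_norm_sq,
    (hA.isSymmetric.eigenvectorBasis rfl).orthonormal.1 i] at hlow hup
  simpa using And.intro hlow hup

theorem energy_aeval_le (hA : HasSpectralBounds A a c) (ha : 0 ≤ a) {p : Polynomial ℝ}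
    (hp : ∀ x ∈ Set.Icc a c, |p.eval x| ≤ M) (v : E) :
    ⟪Polynomial.aeval (A : E →ₗ[ℝ] E) p v, A (Polynomial.aeval (A : E →ₗ[ℝ] E) p v)⟫_ℝ ≤
      M ^ 2 * ⟪v, A v⟫_ℝ := by
  have energy_eq := inner_apply_self_eq_sum_eigenvalues hA.isSymmetric
  simp only [ContinuousLinearMap.coe_coe] at energy_eq
  rw [energy_eq, energy_eq, Finset.mul_sum]
  refine Finset.sum_le_sum fun i _ => ?_
  have hi := hA.eigenvalues_mem_Icc i
  have hnonneg : 0 ≤ hA.isSymmetric.eigenvalues rfl i := ha.trans hi.1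
  rw [repr_eigenvectorBasis_aeval, mul_pow, mul_left_comm]
  gcongr ?_ * _
  exact sq_le_sq' (neg_le_of_abs_le (hp _ hi)) (le_of_abs_le (hp _ hi))

end HasSpectralBounds

end Operators

section ConjugateGradientOrthogonality

open scoped InnerProductSpace

variable {E : Type*} [NormedAddCommGroup E] [InnerProductSpace ℝ E]

/-- The residual `b - A x` carried by conjugate gradient after `q` iterations. -/
noncomputable def cgResidual (A : E →L[ℝ] E) (b : E) (q : ℕ) : E := (cgState A b q).r

/-- The search direction of conjugate gradient after `q` iterations. -/
noncomputable def cgDirection (A : E →L[ℝ] E) (b : E) (q : ℕ) : E := (cgState A b q).d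

/-- The step length of the `q`-th conjugate gradient iteration. It is the junk value `0` once
the residual vanishes, so that the iteration stays put from then on. -/
noncomputable def cgAlpha (A : E →L[ℝ] E) (b : E) (q : ℕ) : ℝ :=
  ‖cgResidual A b q‖ ^ 2 / ⟪cgDirection A b q, A (cgDirection A b q)⟫_ℝ

/-- The weight of the old search direction in the new one, at the `q`-th conjugate gradient
iteration; as for `cgAlpha`, it is `0` once the residual vanishes. -/
noncomputable def cgBeta (A : E →L[ℝ] E) (b : E) (q : ℕ) : ℝ :=
  ‖cgResidual A b (q + 1)‖ ^ 2 / ‖cgResidual A b q‖ ^ 2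

/-- The span of the first `q` search directions of conjugate gradient; as long as the residual
does not vanish it is the Krylov space of `b, A b, …, A ^ (q - 1) b`. -/
def cgSpan (A : E →L[ℝ] E) (b : E) (q : ℕ) : Submodule ℝ E :=
  Submodule.span ℝ (cgDirection A b '' Set.Iio q)

section Recursion

variable (A : E →L[ℝ] E) (b : E)

theorem cgIterate_succ (q : ℕ) :
    cgIterate A b (q + 1) = cgIterate A b q + cgAlpha A b q • cgDirection A b q := rfl

theorem cgResidual_succ (q : ℕ) :
    cgResidual A b (q + 1) = cgResidual A b q - cgAlpha A b q • A (cgDirection A b q) := rfl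

theorem cgDirection_succ (q : ℕ) :
    cgDirection A b (q + 1) = cgResidual A b (q + 1) + cgBeta A b q • cgDirection A b q := rfl

theorem cgResidual_eq_sub (q : ℕ) : cgResidual A b q = b - A (cgIterate A b q) := by
  induction q with
  | zero => simp [cgResidual, cgIterate, cgState]
  | succ q ih => rw [cgResidual_succ, cgIterate_succ, map_add, map_smul, ih]; abel

variable {A b}

theorem cgDirection_eq_zero {q : ℕ} (h : cgResidual A b q = 0) : cgDirection A b q = 0 := by
  cases q with
  | zero => exact h
  | succ q => simp [cgDirection_succ, cgBeta, h]

theorem cgResidual_eq_zero_of_le {q q' : ℕ} (hq : q ≤ q') (h : cgResidual A b q = 0) :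
    cgResidual A b q' = 0 := by
  induction q', hq using Nat.le_induction with
  | base => exact h
  | succ k _ ih => simp [cgResidual_succ, cgAlpha, ih]

end Recursion

section Span

variable (A : E →L[ℝ] E) (b : E)

theorem cgSpan_mono : Monotone (cgSpan A b) := fun _ _ h =>
  Submodule.span_mono (Set.image_mono (Set.Iio_subset_Iio h))

theorem cgDirection_mem_cgSpan {i q : ℕ} (h : i < q) : cgDirection A b i ∈ cgSpan A b q :=
  Submodule.subset_span ⟨i, h, rfl⟩

theorem cgIterate_mem_cgSpan (q : ℕ) : cgIterate A b q ∈ cgSpan A b q := by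
  induction q with
  | zero => exact Submodule.zero_mem _
  | succ q ih =>
    rw [cgIterate_succ]
    exact Submodule.add_mem _ (cgSpan_mono A b q.le_succ ih)
      (Submodule.smul_mem _ _ (cgDirection_mem_cgSpan A b q.lt_succ_self))

theorem cgResidual_mem_cgSpan (q : ℕ) : cgResidual A b q ∈ cgSpan A b (q + 1) := by
  cases q with
  | zero => exact cgDirection_mem_cgSpan A b Nat.zero_lt_one
  | succ q =>
    rw [eq_sub_of_add_eq (cgDirection_succ A b q).symm]
    exact Submodule.sub_mem _ (cgDirection_mem_cgSpan A b (by omega))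
      (Submodule.smul_mem _ _ (cgDirection_mem_cgSpan A b (by omega)))

variable {A b}

theorem inner_eq_zero_of_mem_cgSpan {v w : E} {q : ℕ}
    (h : ∀ i < q, ⟪w, cgDirection A b i⟫_ℝ = 0) (hv : v ∈ cgSpan A b q) : ⟪w, v⟫_ℝ = 0 := by
  have hle : cgSpan A b q ≤ LinearMap.ker (innerₗ E w) := by
    refine Submodule.span_le.2 ?_
    rintro _ ⟨i, hi, rfl⟩
    exact h i hi
  exact hle hv

end Span

variable {A : E →L[ℝ] E} {b : E} {q : ℕ}

/-- The orthogonality relations at iteration `q` of conjugate gradient, as the invariant of an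
induction: the residual is orthogonal, and the direction conjugate, to earlier directions. -/
structure CGOrthogonal (A : E →L[ℝ] E) (b : E) (q : ℕ) : Prop where
  residual : ∀ i < q, ⟪cgResidual A b q, cgDirection A b i⟫_ℝ = 0
  direction : ∀ i < q, ⟪cgDirection A b q, A (cgDirection A b i)⟫_ℝ = 0

namespace CGOrthogonal

theorem inner_residual_direction_self (h : CGOrthogonal A b q) :
    ⟪cgResidual A b q, cgDirection A b q⟫_ℝ = ‖cgResidual A b q‖ ^ 2 := by
  cases q with
  | zero => exact real_inner_self_eq_norm_sq b
  | succ q =>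
    rw [cgDirection_succ, inner_add_right, real_inner_smul_right, h.residual q q.lt_succ_self,
      real_inner_self_eq_norm_sq, mul_zero, add_zero]

theorem residual_eq_zero (h : CGOrthogonal A b q) (hd : cgDirection A b q = 0) :
    cgResidual A b q = 0 := by
  simpa [hd] using h.inner_residual_direction_self.symm

theorem alpha_mul_energy (h : CGOrthogonal A b q) (hA : IsPositiveDefinite A) :
    cgAlpha A b q * ⟪cgDirection A b q, A (cgDirection A b q)⟫_ℝ = ‖cgResidual A b q‖ ^ 2 := by
  by_cases hd : cgDirection A b q = 0
  · simp [hd, h.residual_eq_zero hd]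
  · exact div_mul_cancel₀ _ (hA.energy_pos _ hd).ne'

theorem map_direction_eq (h : CGOrthogonal A b q) (hA : IsPositiveDefinite A) :
    A (cgDirection A b q) =
      (cgAlpha A b q)⁻¹ • (cgResidual A b q - cgResidual A b (q + 1)) := by
  rw [cgResidual_succ, sub_sub_cancel]
  by_cases hα : cgAlpha A b q = 0
  · have hr : cgResidual A b q = 0 := by simpa [hα] using (h.alpha_mul_energy hA).symm
    simp [cgDirection_eq_zero hr]
  · rw [inv_smul_smul₀ hα]

theorem map_direction_mem (h : CGOrthogonal A b q) (hA : IsPositiveDefinite A) :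
    A (cgDirection A b q) ∈ cgSpan A b (q + 2) := by
  rw [h.map_direction_eq hA]
  exact Submodule.smul_mem _ _ (Submodule.sub_mem _
    (cgSpan_mono A b (by omega) (cgResidual_mem_cgSpan A b q)) (cgResidual_mem_cgSpan A b (q + 1)))

theorem residual_succ (h : CGOrthogonal A b q) (hA : IsPositiveDefinite A) :
    ∀ i < q + 1, ⟪cgResidual A b (q + 1), cgDirection A b i⟫_ℝ = 0 := by
  intro i hi
  have hsymm : ⟪A (cgDirection A b q), cgDirection A b i⟫_ℝ =
      ⟪cgDirection A b q, A (cgDirection A b i)⟫_ℝ := hA.isSymmetric _ _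
  rw [cgResidual_succ, inner_sub_left, real_inner_smul_left, hsymm]
  rcases Nat.lt_succ_iff_lt_or_eq.1 hi with hi | rfl
  · rw [h.residual i hi, h.direction i hi, mul_zero, sub_zero]
  · rw [h.inner_residual_direction_self, h.alpha_mul_energy hA, sub_self]

theorem direction_succ_self (h : CGOrthogonal A b q) (hA : IsPositiveDefinite A) :
    ⟪cgDirection A b (q + 1), A (cgDirection A b q)⟫_ℝ = 0 := by
  have hrr : ⟪cgResidual A b (q + 1), cgResidual A b q⟫_ℝ = 0 :=
    inner_eq_zero_of_mem_cgSpan (h.residual_succ hA) (cgResidual_mem_cgSpan A b q)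
  have hrd : ⟪cgResidual A b (q + 1), A (cgDirection A b q)⟫_ℝ =
      -((cgAlpha A b q)⁻¹ * ‖cgResidual A b (q + 1)‖ ^ 2) := by
    rw [h.map_direction_eq hA, real_inner_smul_right, inner_sub_right, hrr,
      real_inner_self_eq_norm_sq]
    ring
  rw [cgDirection_succ, inner_add_left, real_inner_smul_left, hrd, cgAlpha, cgBeta, inv_div]
  ring

end CGOrthogonal

theorem cgOrthogonal (hA : IsPositiveDefinite A) (b : E) (q : ℕ) : CGOrthogonal A b q := by
  induction q using Nat.strong_induction_on with
  | _ q ih =>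
  cases q with
  | zero => exact ⟨by simp, by simp⟩
  | succ q =>
  have hq := ih q q.lt_succ_self
  have hr := hq.residual_succ hA
  refine ⟨hr, fun i hi => ?_⟩
  rcases Nat.lt_succ_iff_lt_or_eq.1 hi with hi | rfl
  · have hrA : ⟪cgResidual A b (q + 1), A (cgDirection A b i)⟫_ℝ = 0 :=
      inner_eq_zero_of_mem_cgSpan hr
        (cgSpan_mono A b (by omega) ((ih i (by omega)).map_direction_mem hA))
    rw [cgDirection_succ, inner_add_left, real_inner_smul_left, hrA, hq.direction i hi,
      mul_zero, add_zero]
  · exact hq.direction_succ_self hA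

theorem inner_cgResidual_eq_zero (hA : IsPositiveDefinite A) {v : E} (hv : v ∈ cgSpan A b q) :
    ⟪cgResidual A b q, v⟫_ℝ = 0 :=
  inner_eq_zero_of_mem_cgSpan (cgOrthogonal hA b q).residual hv

theorem cgResidual_finrank_eq_zero [FiniteDimensional ℝ E] (hA : IsPositiveDefinite A) (b : E) :
    cgResidual A b (Module.finrank ℝ E) = 0 := by
  by_contra hne
  have hne' : ∀ i : Fin (Module.finrank ℝ E + 1), cgResidual A b i ≠ 0 := fun i h =>
    hne (cgResidual_eq_zero_of_le (Nat.lt_succ_iff.1 i.2) h)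
  have horth : ∀ i j : ℕ, i < j → ⟪cgResidual A b j, cgResidual A b i⟫_ℝ = 0 := fun i j hij =>
    inner_cgResidual_eq_zero hA (cgSpan_mono A b hij (cgResidual_mem_cgSpan A b i))
  have hli : LinearIndependent ℝ
      (fun i : Fin (Module.finrank ℝ E + 1) => cgResidual A b i) := by
    refine linearIndependent_of_ne_zero_of_inner_eq_zero hne' fun i j hij => ?_
    rcases lt_or_gt_of_ne (Fin.val_ne_of_ne hij) with h | h
    · rw [real_inner_comm]; exact horth _ _ h
    · exact horth _ _ h
  simpa using hli.fintype_card_le_finrank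

end ConjugateGradientOrthogonality

section ConjugateGradientMinimality

open Polynomial
open scoped InnerProductSpace

variable {E : Type*} [NormedAddCommGroup E] [InnerProductSpace ℝ E] {A : E →L[ℝ] E} {e : E}
  {q : ℕ}

theorem map_mem_cgSpan_succ (hA : IsPositiveDefinite A) {b v : E} (hv : v ∈ cgSpan A b q) :
    A v ∈ cgSpan A b (q + 1) := by
  have hle : cgSpan A b q ≤ (cgSpan A b (q + 1)).comap (A : E →ₗ[ℝ] E) := by
    refine Submodule.span_le.2 ?_
    rintro _ ⟨i, hi, rfl⟩
    exact cgSpan_mono A b (Nat.succ_le_succ hi) ((cgOrthogonal hA b i).map_direction_mem hA)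
  exact hle hv

theorem pow_apply_mem_cgSpan (hA : IsPositiveDefinite A) (b : E) (i : ℕ) :
    ((A : E →ₗ[ℝ] E) ^ i) b ∈ cgSpan A b (i + 1) := by
  induction i with
  | zero => exact cgDirection_mem_cgSpan A b Nat.zero_lt_one
  | succ i ih =>
    rw [pow_succ']
    exact map_mem_cgSpan_succ hA ih

theorem aeval_apply_mem_cgSpan (hA : IsPositiveDefinite A) (b : E) {p : ℝ[X]}
    (hp : p.natDegree < q) : aeval (A : E →ₗ[ℝ] E) p b ∈ cgSpan A b q := by
  rw [aeval_eq_sum_range' hp, LinearMap.sum_apply]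
  exact Submodule.sum_mem _ fun i hi => Submodule.smul_mem _ _
    (cgSpan_mono A b (Finset.mem_range.1 hi) (pow_apply_mem_cgSpan hA b i))

/- By Galerkin orthogonality the iterate is the energy projection of the solution `e`. -/
theorem energy_sub_cgIterate_le (hA : IsPositiveDefinite A) {v : E}
    (hv : v ∈ cgSpan A (A e) q) :
    ⟪e - cgIterate A (A e) q, A (e - cgIterate A (A e) q)⟫_ℝ ≤ ⟪e - v, A (e - v)⟫_ℝ := by
  have hr : A (e - cgIterate A (A e) q) = cgResidual A (A e) q := by
    rw [cgResidual_eq_sub, map_sub]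
  have galerkin : ⟪A (e - cgIterate A (A e) q), cgIterate A (A e) q - v⟫_ℝ = 0 := by
    rw [hr]
    exact inner_cgResidual_eq_zero hA
      (Submodule.sub_mem _ (cgIterate_mem_cgSpan A (A e) q) hv)
  rw [← sub_add_sub_cancel e (cgIterate A (A e) q) v, hA.energy_add, galerkin]
  linarith [hA.energy_nonneg (cgIterate A (A e) q - v)]

theorem sub_aeval_mem_cgSpan (hA : IsPositiveDefinite A) (e : E) {p : ℝ[X]}
    (hp : p.eval 0 = 1) (hdeg : p.natDegree ≤ q) :
    e - aeval (A : E →ₗ[ℝ] E) p e ∈ cgSpan A (A e) q := by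
  have hdivX : e - aeval (A : E →ₗ[ℝ] E) p e = -aeval (A : E →ₗ[ℝ] E) p.divX (A e) := by
    conv_lhs => rw [← divX_mul_X_add p]
    simp [coeff_zero_eq_eval_zero, hp]
  rw [hdivX]
  refine Submodule.neg_mem _ ?_
  by_cases h0 : p.natDegree = 0
  · simp [divX_eq_zero_iff.2 (eq_C_of_natDegree_eq_zero h0)]
  · exact aeval_apply_mem_cgSpan hA _ (by rw [natDegree_divX_eq_natDegree_tsub_one]; omega)

theorem energy_sub_cgIterate_le_aeval (hA : IsPositiveDefinite A) {p : ℝ[X]}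
    (hp : p.eval 0 = 1) (hdeg : p.natDegree ≤ q) :
    ⟪e - cgIterate A (A e) q, A (e - cgIterate A (A e) q)⟫_ℝ ≤
      ⟪aeval (A : E →ₗ[ℝ] E) p e, A (aeval (A : E →ₗ[ℝ] E) p e)⟫_ℝ := by
  simpa only [sub_sub_cancel] using
    energy_sub_cgIterate_le hA (sub_aeval_mem_cgSpan hA e hp hdeg)

end ConjugateGradientMinimality

section ChebyshevBound

open Polynomial

variable {a κ x : ℝ}

theorem two_div_le_log_div (hx : 1 < x) : 2 / x ≤ Real.log ((x + 1) / (x - 1)) := by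
  have hx0 : 0 < x := by linarith
  have hinv : 1 / x < 1 := (div_lt_one hx0).2 hx
  have hlog : Real.log (1 + 1 / x) - Real.log (1 - 1 / x) = Real.log ((x + 1) / (x - 1)) := by
    rw [← Real.log_div (by positivity) (by linarith)]
    congr 1
    field_simp
  have habs : |1 / x| < 1 := by rwa [abs_of_pos (by positivity)]
  have hfirst := le_hasSum (Real.hasSum_log_sub_log_of_abs_lt_one habs) 0
    (fun j _ => by positivity)
  rw [hlog] at hfirst
  simpa [div_eq_mul_inv] using hfirst

theorem cosh_log_div (hx : 1 < x) :
    Real.cosh (Real.log ((x + 1) / (x - 1))) = (x ^ 2 + 1) / (x ^ 2 - 1) := by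
  have hx1 : 0 < x - 1 := by linarith
  have hxx : x ^ 2 - 1 = (x + 1) * (x - 1) := by ring
  rw [Real.cosh_eq, Real.exp_neg, Real.exp_log (by positivity), hxx]
  field_simp
  ring

theorem exp_div_two_le_eval_chebyshev (hκ : 1 < κ) (q : ℕ) :
    Real.exp (2 * q / √κ) / 2 ≤ (Chebyshev.T ℝ q).eval ((κ + 1) / (κ - 1)) := by
  have hs : 1 < √κ := Real.lt_sqrt_of_sq_lt (by simpa using hκ)
  have hcosh := cosh_log_div hs
  rw [Real.sq_sqrt (by linarith)] at hcosh
  rw [← hcosh, Chebyshev.T_real_cosh, Real.cosh_eq]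
  have hexp : Real.exp (2 * q / √κ) ≤
      Real.exp (((q : ℤ) : ℝ) * Real.log ((√κ + 1) / (√κ - 1))) := by
    refine Real.exp_le_exp.2 ?_
    calc 2 * q / √κ = q * (2 / √κ) := by ring
      _ ≤ q * Real.log ((√κ + 1) / (√κ - 1)) := by gcongr; exact two_div_le_log_div hs
      _ = _ := by push_cast; rfl
  linarith [Real.exp_pos (-(((q : ℤ) : ℝ) * Real.log ((√κ + 1) / (√κ - 1))))]

theorem eval_chebyshev_pos (hκ : 1 < κ) (q : ℕ) :
    0 < (Chebyshev.T ℝ q).eval ((κ + 1) / (κ - 1)) :=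
  lt_of_lt_of_le (by positivity) (exp_div_two_le_eval_chebyshev hκ q)

/-- The Chebyshev polynomial of degree `q`, transported from `[-1, 1]` to `[a, κ a]` and
normalized to take the value `1` at `0`. It is the comparison polynomial that yields the
convergence rate of conjugate gradient. -/
noncomputable def cgPolynomial (a κ : ℝ) (q : ℕ) : ℝ[X] :=
  C ((Chebyshev.T ℝ q).eval ((κ + 1) / (κ - 1)))⁻¹ *
    (Chebyshev.T ℝ q).comp (C ((κ + 1) / (κ - 1)) - C (2 / (a * (κ - 1))) * X)

theorem eval_zero_cgPolynomial (a : ℝ) (hκ : 1 < κ) (q : ℕ) : (cgPolynomial a κ q).eval 0 = 1 := by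
  simp [cgPolynomial, eval_comp, (eval_chebyshev_pos hκ q).ne']

theorem natDegree_cgPolynomial_le (a κ : ℝ) (q : ℕ) : (cgPolynomial a κ q).natDegree ≤ q := by
  refine (natDegree_C_mul_le _ _).trans (natDegree_comp_le.trans ?_)
  rw [Chebyshev.natDegree_T]
  refine (Nat.mul_le_mul_left _ (?_ : _ ≤ 1)).trans (by simp)
  compute_degree

theorem abs_eval_cgPolynomial_le (ha : 0 < a) (hκ : 1 < κ) (q : ℕ)
    (hx : x ∈ Set.Icc a (κ * a)) :
    |(cgPolynomial a κ q).eval x| ≤ 2 * Real.exp (-(2 * q / √κ)) := by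
  have hκ1 : 0 < κ - 1 := by linarith
  have hτ := eval_chebyshev_pos hκ q
  have habs : |(κ + 1) / (κ - 1) - 2 / (a * (κ - 1)) * x| ≤ 1 := by
    have hcommon : (κ + 1) / (κ - 1) - 2 / (a * (κ - 1)) * x =
        (a * (κ + 1) - 2 * x) / (a * (κ - 1)) := by field_simp
    rw [hcommon, abs_div, abs_of_pos (mul_pos ha hκ1), div_le_one (mul_pos ha hκ1), abs_le]
    constructor <;> nlinarith [hx.1, hx.2]
  have hT := Chebyshev.abs_eval_T_real_le_one (q : ℤ) habs
  simp only [cgPolynomial, eval_mul, eval_C, eval_comp, eval_sub, eval_X]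
  rw [abs_mul, abs_of_pos (inv_pos.2 hτ)]
  calc _ ≤ ((Chebyshev.T ℝ q).eval ((κ + 1) / (κ - 1)))⁻¹ * 1 := by gcongr
    _ ≤ (Real.exp (2 * q / √κ) / 2)⁻¹ := by
      rw [mul_one]; exact inv_anti₀ (by positivity) (exp_div_two_le_eval_chebyshev hκ q)
    _ = 2 * Real.exp (-(2 * q / √κ)) := by rw [Real.exp_neg, inv_div]; rfl

end ChebyshevBound

section ConjugateGradientRate

open scoped InnerProductSpace

variable {E : Type*} [NormedAddCommGroup E] [InnerProductSpace ℝ E]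

theorem norm_cgResidual_le [FiniteDimensional ℝ E] {A : E →L[ℝ] E} {a c κ : ℝ}
    (hA : HasSpectralBounds A a c) (ha : 0 < a) (hc : 0 ≤ c) (hκ : 1 < κ) (hcκ : c ≤ κ * a)
    (b : E) (q : ℕ) :
    ‖cgResidual A b q‖ ≤ 2 * √(c / a) * Real.exp (-(2 * q / √κ)) * ‖b‖ := by
  have hpos := hA.isPositiveDefinite ha
  obtain ⟨e, rfl⟩ := hpos.surjective b
  have hr : cgResidual A (A e) q = A (e - cgIterate A (A e) q) := by
    rw [cgResidual_eq_sub, map_sub]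
  have henergy : ⟪e - cgIterate A (A e) q, A (e - cgIterate A (A e) q)⟫_ℝ ≤
      (2 * Real.exp (-(2 * q / √κ))) ^ 2 * (‖A e‖ ^ 2 / a) :=
    calc _ ≤ _ := energy_sub_cgIterate_le_aeval hpos (eval_zero_cgPolynomial a hκ q)
            (natDegree_cgPolynomial_le a κ q)
      _ ≤ (2 * Real.exp (-(2 * q / √κ))) ^ 2 * ⟪e, A e⟫_ℝ :=
        (hA.mono_right hcκ).energy_aeval_le ha.le
          (fun _ => abs_eval_cgPolynomial_le ha hκ q) e
      _ ≤ _ := by gcongr; exact hA.energy_le_norm_sq_div ha e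
  refine le_of_sq_le_sq ?_ (by positivity)
  rw [hr]
  calc ‖A (e - cgIterate A (A e) q)‖ ^ 2
      ≤ c * ((2 * Real.exp (-(2 * q / √κ))) ^ 2 * (‖A e‖ ^ 2 / a)) :=
        (hA.norm_sq_le_energy ha.le _).trans (by gcongr)
    _ = _ := by
        rw [mul_pow, mul_pow, mul_pow, mul_pow, Real.sq_sqrt (by positivity)]
        ring

variable {H : E →L[ℝ] E} {γ θ κ : ℝ} {g : E}

theorem hasSpectralBounds_regularized (hH : H.IsPositive) (γ : ℝ) :
    HasSpectralBounds (H + γ • ContinuousLinearMap.id ℝ E) γ (‖H‖ + γ) := by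
  have energy_eq : ∀ v, ⟪v, (H + γ • ContinuousLinearMap.id ℝ E) v⟫_ℝ =
      ⟪v, H v⟫_ℝ + γ * ‖v‖ ^ 2 := fun v => by
    simp [inner_add_right, inner_smul_right]
  refine ⟨fun v w => ?_, fun v => ?_, fun v => ?_⟩
  · have hsymm : ⟪H v, w⟫_ℝ = ⟪v, H w⟫_ℝ := hH.isSymmetric v w
    simp [inner_add_left, inner_add_right, inner_smul_left, inner_smul_right, hsymm]
  · rw [energy_eq]
    linarith [hH.inner_nonneg_right v]
  · have hle : ⟪v, H v⟫_ℝ ≤ ‖v‖ * (‖H‖ * ‖v‖) :=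
      (real_inner_le_norm v (H v)).trans (by gcongr; exact H.le_opNorm v)
    rw [energy_eq]
    linarith

theorem isPositiveDefinite_regularized (hH : H.IsPositive) (hγ : 0 < γ) :
    IsPositiveDefinite (H + γ • ContinuousLinearMap.id ℝ E) :=
  (hasSpectralBounds_regularized hH γ).isPositiveDefinite hγ

theorem isInexactStep_cgIterate_iff (q : ℕ) :
    IsInexactStep θ γ H g (cgIterate (H + γ • ContinuousLinearMap.id ℝ E) (-g) q) ↔
      ‖cgResidual (H + γ • ContinuousLinearMap.id ℝ E) (-g) q‖ ≤
        θ * √(γ / (‖H‖ + γ)) * ‖g‖ := by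
  rw [IsInexactStep, cgResidual_eq_sub, ← norm_neg (-g - _), neg_sub, sub_neg_eq_add]

theorem inner_cgInexactStep_residual (hH : H.IsPositive) (hγ : 0 < γ) (θ : ℝ) (g : E) :
    ⟪(H + γ • ContinuousLinearMap.id ℝ E) (cgInexactStep θ γ H g) + g,
      cgInexactStep θ γ H g⟫_ℝ = 0 := by
  have horth := inner_cgResidual_eq_zero (isPositiveDefinite_regularized hH hγ)
    (cgIterate_mem_cgSpan _ (-g) (cgCount θ γ H g))
  rw [cgResidual_eq_sub, ← neg_add', inner_neg_left, neg_eq_zero, add_comm] at horth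
  exact horth

theorem energy_cgInexactStep (hH : H.IsPositive) (hγ : 0 < γ) (θ : ℝ) (g : E) :
    ⟪cgInexactStep θ γ H g,
      (H + γ • ContinuousLinearMap.id ℝ E) (cgInexactStep θ γ H g)⟫_ℝ =
      -⟪g, cgInexactStep θ γ H g⟫_ℝ := by
  have horth := inner_cgInexactStep_residual hH hγ θ g
  rw [inner_add_left, real_inner_comm] at horth
  linarith

variable [FiniteDimensional ℝ E]

/- The Chebyshev bound and the tolerance each lose a factor `√((‖H‖ + γ) / γ) ≤ √κ`, whence `κ`
inside the logarithm. -/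
theorem isInexactStep_cgIterate_of_log_le (hH : H.IsPositive)
    (hγ : 0 < γ) (hκ : 1 < κ) (hHκ : ‖H‖ + γ ≤ κ * γ) (hθ : 0 < θ) (g : E) {q : ℕ}
    (hq : 1 / 2 * √κ * Real.log (2 * κ / θ) ≤ q) :
    IsInexactStep θ γ H g (cgIterate (H + γ • ContinuousLinearMap.id ℝ E) (-g) q) := by
  have hs : 0 < √κ := Real.sqrt_pos.2 (by linarith)
  rw [isInexactStep_cgIterate_iff]
  have hc : 0 ≤ ‖H‖ + γ := by positivity
  refine (norm_cgResidual_le (hasSpectralBounds_regularized hH γ) hγ hc hκ hHκ (-g) q).trans ?_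
  rw [norm_neg]
  refine mul_le_mul_of_nonneg_right ?_ (norm_nonneg g)
  have hexp : Real.exp (-(2 * q / √κ)) ≤ θ / (2 * κ) := by
    rw [Real.exp_neg, ← inv_div (2 * κ) θ]
    refine inv_anti₀ (by positivity) ?_
    rw [← Real.log_le_iff_le_exp (by positivity), le_div_iff₀ hs]
    linarith
  have htol : √(γ / (‖H‖ + γ)) = (√((‖H‖ + γ) / γ))⁻¹ := by rw [← Real.sqrt_inv, inv_div]
  have hρκ : (‖H‖ + γ) / γ ≤ κ := (div_le_iff₀ hγ).2 hHκ
  have hρ : 0 < (‖H‖ + γ) / γ := by positivity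
  rw [htol]
  generalize (‖H‖ + γ) / γ = ρ at hρκ hρ
  calc 2 * √ρ * Real.exp (-(2 * q / √κ)) ≤ 2 * √ρ * (θ / (2 * κ)) := by gcongr
    _ ≤ 2 * √ρ * (θ / (2 * ρ)) := by gcongr
    _ = θ * (√ρ / ρ) := by field_simp
    _ = θ * (√ρ)⁻¹ := by rw [Real.sqrt_div_self', one_div]

theorem isInexactStep_cgIterate_finrank (hH : H.IsPositive) (hγ : 0 < γ) (hθ : 0 ≤ θ) (g : E) :
    IsInexactStep θ γ H g
      (cgIterate (H + γ • ContinuousLinearMap.id ℝ E) (-g) (Module.finrank ℝ E)) := by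
  rw [isInexactStep_cgIterate_iff,
    cgResidual_finrank_eq_zero (isPositiveDefinite_regularized hH hγ), norm_zero]
  positivity

theorem isInexactStep_cgInexactStep (hH : H.IsPositive) (hγ : 0 < γ) (hθ : 0 ≤ θ) (g : E) :
    IsInexactStep θ γ H g (cgInexactStep θ γ H g) :=
  Nat.sInf_mem (s := {q : ℕ | IsInexactStep θ γ H g
    (cgIterate (H + γ • ContinuousLinearMap.id ℝ E) (-g) q)})
    ⟨_, isInexactStep_cgIterate_finrank hH hγ hθ g⟩

theorem cgCount_le_cgBound (hH : H.IsPositive) (hγ : 0 < γ) (hκ : 1 < κ)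
    (hHκ : ‖H‖ + γ ≤ κ * γ) (hθ : 0 ≤ θ) (g : E) :
    cgCount θ γ H g ≤ cgBound (Module.finrank ℝ E) κ θ := by
  have hfinrank : cgCount θ γ H g ≤ Module.finrank ℝ E :=
    Nat.sInf_le (isInexactStep_cgIterate_finrank hH hγ hθ g)
  rw [cgBound]
  split_ifs with hθ0
  · exact hfinrank
  · exact le_min hfinrank (Nat.sInf_le (isInexactStep_cgIterate_of_log_le hH hγ hκ hHκ
      (lt_of_le_of_ne hθ (Ne.symm hθ0)) g (Nat.le_ceil _)))

theorem le_energy_cgInexactStep (hH : H.IsPositive) (hγ : 0 < γ) (hθ : 0 ≤ θ) (g : E) :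
    (1 - θ ^ 2) * ‖g‖ ^ 2 / (‖H‖ + γ) ≤ ⟪cgInexactStep θ γ H g,
      (H + γ • ContinuousLinearMap.id ℝ E) (cgInexactStep θ γ H g)⟫_ℝ := by
  have hc : 0 < ‖H‖ + γ := by positivity
  have hres : ‖(H + γ • ContinuousLinearMap.id ℝ E) (cgInexactStep θ γ H g) + g‖ ^ 2 ≤
      θ ^ 2 * (γ / (‖H‖ + γ)) * ‖g‖ ^ 2 :=
    calc _ ≤ (θ * √(γ / (‖H‖ + γ)) * ‖g‖) ^ 2 := by
          gcongr; exact isInexactStep_cgInexactStep hH hγ hθ g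
      _ = _ := by rw [mul_pow, mul_pow, Real.sq_sqrt (by positivity)]
  refine le_trans ?_ ((hasSpectralBounds_regularized hH γ).le_energy_of_inner_eq_zero hγ hc
    (inner_cgInexactStep_residual hH hγ θ g))
  calc (1 - θ ^ 2) * ‖g‖ ^ 2 / (‖H‖ + γ)
      = ‖g‖ ^ 2 / (‖H‖ + γ) - θ ^ 2 * (γ / (‖H‖ + γ)) * ‖g‖ ^ 2 / γ := by field_simp
    _ ≤ _ := by gcongr

end ConjugateGradientRate

section PartialDerivatives

variable {𝕜 E₁ E₂ F : Type*} [NontriviallyNormedField 𝕜]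
  [NormedAddCommGroup E₁] [NormedSpace 𝕜 E₁] [NormedAddCommGroup E₂] [NormedSpace 𝕜 E₂]
  [NormedAddCommGroup F] [NormedSpace 𝕜 F]
  {f : E₁ × E₂ → F} {f' : E₁ × E₂ →L[𝕜] F} {a : E₁} {b : E₂}

theorem fderiv_prodMk_left (hf : HasFDerivAt f f' (a, b)) :
    fderiv 𝕜 (fun x => f (x, b)) a = f' ∘L .inl 𝕜 E₁ E₂ :=
  (HasFDerivAt.comp a hf (hasFDerivAt_prodMk_left a b)).fderiv

theorem fderiv_prodMk_right (hf : HasFDerivAt f f' (a, b)) :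
    fderiv 𝕜 (fun y => f (a, y)) b = f' ∘L .inr 𝕜 E₁ E₂ :=
  (HasFDerivAt.comp b hf (hasFDerivAt_prodMk_right a b)).fderiv

theorem hasFDerivAt_of_unique_solution [CompleteSpace E₁] [CompleteSpace E₂] [CompleteSpace F]
    {φ : E₁ → E₂} (hf : HasStrictFDerivAt f f' (a, φ a))
    (hinv : (f' ∘L .inr 𝕜 E₁ E₂).IsInvertible)
    (hφ : ∀ x y, f (x, y) = f (a, φ a) → y = φ x) :
    HasFDerivAt φ (-(f' ∘L .inr 𝕜 E₁ E₂).inverse ∘L (f' ∘L .inl 𝕜 E₁ E₂)) a := by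
  refine (hf.hasStrictFDerivAt_implicitFunctionOfProdDomain hinv).hasFDerivAt.congr_of_eventuallyEq
    ?_
  filter_upwards [hf.eventually_apply_implicitFunctionOfProdDomain hinv] with x hx
  exact (hφ x _ hx).symm

end PartialDerivatives

theorem le_add_inner_add_sq_of_lipschitz_gradient {E : Type*} [NormedAddCommGroup E]
    [InnerProductSpace ℝ E] [CompleteSpace E] {f : E → ℝ} {f' : E → E} {L : ℝ}
    (hf : ∀ v, HasGradientAt f (f' v) v) (hL : ∀ v w, ‖f' v - f' w‖ ≤ L * ‖v - w‖) (u s : E) :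
    f (u + s) ≤ f u + inner ℝ (f' u) s + L / 2 * ‖s‖ ^ 2 := by
  have hline : ∀ t : ℝ, HasDerivAt (fun t : ℝ => f (u + t • s)) (inner ℝ (f' (u + t • s)) s) t := by
    intro t
    have hpath : HasDerivAt (fun t : ℝ => u + t • s) s t := by
      simpa using ((hasDerivAt_id t).smul_const s).const_add u
    exact ((hf (u + t • s)).hasFDerivAt.comp_hasDerivAt t hpath).congr_deriv (by simp)
  have hquad : ∀ t : ℝ, HasDerivAt
      (fun t : ℝ => f u + t * inner ℝ (f' u) s + L / 2 * ‖s‖ ^ 2 * t ^ 2)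
      (inner ℝ (f' u) s + L * ‖s‖ ^ 2 * t) t := by
    intro t
    refine ((((hasDerivAt_id t).mul_const (inner ℝ (f' u) s)).const_add (f u)).add
      ((hasDerivAt_pow 2 t).const_mul (L / 2 * ‖s‖ ^ 2))).congr_deriv ?_
    push_cast
    ring
  have hslope : ∀ t ∈ Set.Ico (0 : ℝ) 1,
      inner ℝ (f' (u + t • s)) s ≤ inner ℝ (f' u) s + L * ‖s‖ ^ 2 * t := by
    intro t ht
    have hdiff : inner ℝ (f' (u + t • s) - f' u) s ≤ L * ‖s‖ ^ 2 * t :=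
      calc inner ℝ (f' (u + t • s) - f' u) s
          ≤ ‖f' (u + t • s) - f' u‖ * ‖s‖ := real_inner_le_norm _ _
        _ ≤ L * ‖u + t • s - u‖ * ‖s‖ := by gcongr; exact hL _ _
        _ = L * ‖s‖ ^ 2 * t := by
          rw [add_sub_cancel_left, norm_smul, Real.norm_of_nonneg ht.1]; ring
    rw [inner_sub_left] at hdiff
    linarith
  have hle := image_le_of_deriv_right_le_deriv_boundary
    (fun t _ => (hline t).continuousAt.continuousWithinAt) (fun t _ => (hline t).hasDerivWithinAt)
    (by simp) (fun t _ => (hquad t).continuousAt.continuousWithinAt)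
    (fun t _ => (hquad t).hasDerivWithinAt) hslope (Set.right_mem_Icc.2 zero_le_one)
  simpa using hle

namespace ImplicitLS

variable {ny n m p : ℕ} {P : ImplicitLS ny n m p}

theorem WellPosed.hasFDerivAt_y (hP : P.WellPosed) (u : Euc n) :
    HasFDerivAt P.y (-(P.cy u).inverse ∘L P.cu u) u := by
  have hc : ContDiff ℝ 1 (P.c ∘ Prod.swap) :=
    hP.contDiff_c.comp (contDiff_snd.prodMk contDiff_fst)
  have hstrict : HasStrictFDerivAt (P.c ∘ Prod.swap) (fderiv ℝ (P.c ∘ Prod.swap) (u, P.y u))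
      (u, P.y u) := hc.contDiffAt.hasStrictFDerivAt one_ne_zero
  have hcy : P.cy u = fderiv ℝ (P.c ∘ Prod.swap) (u, P.y u) ∘L .inr ℝ (Euc n) (Euc ny) :=
    fderiv_prodMk_right hstrict.hasFDerivAt
  have hcu : P.cu u = fderiv ℝ (P.c ∘ Prod.swap) (u, P.y u) ∘L .inl ℝ (Euc n) (Euc ny) :=
    fderiv_prodMk_left hstrict.hasFDerivAt
  have hinv := hP.invertible_cy u
  rw [hcy] at hinv ⊢
  rw [hcu]
  refine hasFDerivAt_of_unique_solution hstrict hinv fun w v hwv => (hP.solution w v).1 ?_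
  exact hwv.trans ((hP.solution u _).2 rfl)

theorem WellPosed.hasFDerivAt_Rhat (hP : P.WellPosed) (u : Euc n) :
    HasFDerivAt P.Rhat (P.Ghat u) u := by
  have hR := (hP.differentiable_R u).hasFDerivAt
  have hchain := HasFDerivAt.comp u (f := fun w => (P.y w, w)) hR
    ((hP.hasFDerivAt_y u).prodMk (hasFDerivAt_id u))
  refine hchain.congr_fderiv ?_
  rw [Ghat, Gy, Gu, fderiv_prodMk_left hR, fderiv_prodMk_right hR]
  ext1 v
  simp [← map_sub]

theorem WellPosed.hasGradientAt_Jhat (hP : P.WellPosed) (u : Euc n) :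
    HasGradientAt P.Jhat (P.grad u) u := by
  rw [hasGradientAt_iff_hasFDerivAt]
  refine ((hP.hasFDerivAt_Rhat u).norm_sq.const_mul (1 / 2 : ℝ)).congr_fderiv ?_
  ext1 v
  simp [grad, ContinuousLinearMap.adjoint_inner_left]

theorem WellPosed.Jhat_add_le (hP : P.WellPosed) {L : ℝ} (hL : P.LipschitzGradient L)
    (u s : Euc n) : P.Jhat (u + s) ≤ P.Jhat u + inner ℝ (P.grad u) s + L / 2 * ‖s‖ ^ 2 := by
  refine le_add_inner_add_sq_of_lipschitz_gradient hP.hasGradientAt_Jhat (fun v w => ?_) u s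
  rw [← (hP.hasGradientAt_Jhat v).gradient, ← (hP.hasGradientAt_Jhat w).gradient]
  exact hL.2 v w

end ImplicitLS

namespace ImplicitLS

variable {ny n m p : ℕ} {P : ImplicitLS ny n m p} {θ γ η L εR εg : ℝ} {H : Euc n →L[ℝ] Euc n}
  {v : Euc n}

theorem model_zero_sub_model_step (hH : H.IsPositive) (hγ : 0 < γ) (θ : ℝ) (v : Euc n) :
    P.model v H γ 0 - P.model v H γ (P.step θ v H γ) =
      1 / 2 * inner ℝ (P.step θ v H γ)
        ((H + γ • ContinuousLinearMap.id ℝ (Euc n)) (P.step θ v H γ)) := by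
  have henergy := energy_cgInexactStep hH hγ θ (P.grad v)
  rw [model, model, step]
  simp only [inner_zero_right, inner_zero_left]
  linarith

theorem le_predicted_decrease (hH : H.IsPositive) (hγ : 0 < γ) (hθ : 0 ≤ θ) (v : Euc n) :
    (1 - θ ^ 2) * ‖P.grad v‖ ^ 2 / (2 * (‖H‖ + γ)) ≤
      P.model v H γ 0 - P.model v H γ (P.step θ v H γ) := by
  rw [model_zero_sub_model_step hH hγ]
  calc (1 - θ ^ 2) * ‖P.grad v‖ ^ 2 / (2 * (‖H‖ + γ))
      = 1 / 2 * ((1 - θ ^ 2) * ‖P.grad v‖ ^ 2 / (‖H‖ + γ)) := by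
        rw [mul_comm 2, ← div_div]; ring
    _ ≤ _ := by gcongr; exact le_energy_cgInexactStep hH hγ hθ (P.grad v)

theorem predicted_decrease_pos (hH : H.IsPositive) (hγ : 0 < γ) (hθ : 0 ≤ θ) (hθ1 : θ < 1)
    (hg : P.grad v ≠ 0) : 0 < P.model v H γ 0 - P.model v H γ (P.step θ v H γ) := by
  have hθsq : 0 < 1 - θ ^ 2 := by nlinarith
  exact lt_of_lt_of_le (by positivity) (le_predicted_decrease hH hγ hθ v)

theorem step_ne_zero (hH : H.IsPositive) (hγ : 0 < γ) (hθ : 0 ≤ θ) (hθ1 : θ < 1)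
    (hg : P.grad v ≠ 0) : P.step θ v H γ ≠ 0 := fun hs =>
  (predicted_decrease_pos hH hγ hθ hθ1 hg).ne' (by rw [hs, sub_self])

theorem WellPosed.le_ratio (hP : P.WellPosed) (hL : P.LipschitzGradient L) (hH : H.IsPositive)
    (hη1 : η < 1) (hγ : 0 < γ) (hLγ : L / (1 - η) ≤ γ) (hθ : 0 ≤ θ) (hθ1 : θ < 1)
    (hg : P.grad v ≠ 0) : η ≤ P.ratio v H γ (P.step θ v H γ) := by
  have hdescent := hP.Jhat_add_le hL v (P.step θ v H γ)
  have henergy := energy_cgInexactStep hH hγ θ (P.grad v)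
  have hlow := (hasSpectralBounds_regularized hH γ).le_energy (P.step θ v H γ)
  rw [ratio, le_div_iff₀ (predicted_decrease_pos hH hγ hθ hθ1 hg), model_zero_sub_model_step hH hγ]
  rw [← step] at henergy
  generalize P.step θ v H γ = s at *
  have hη0 : 0 < 1 - η := by linarith
  have hcurv : L * ‖s‖ ^ 2 ≤
      (1 - η) * inner ℝ s ((H + γ • ContinuousLinearMap.id ℝ (Euc n)) s) :=
    calc L * ‖s‖ ^ 2 ≤ (1 - η) * γ * ‖s‖ ^ 2 := by
          gcongr; rwa [div_le_iff₀' hη0] at hLγ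
      _ = (1 - η) * (γ * ‖s‖ ^ 2) := mul_assoc _ _ _
      _ ≤ _ := by gcongr
  linarith [mul_nonneg hγ.le (sq_nonneg ‖s‖)]

/- The ratio is `0 / 0` here, so such a step is rejected. -/
theorem ratio_step_eq_zero (θ γ : ℝ) (H : Euc n →L[ℝ] Euc n) (hg : P.grad v = 0) :
    P.ratio v H γ (P.step θ v H γ) = 0 := by
  have hcount : cgCount θ γ H (P.grad v) = 0 :=
    Nat.sInf_eq_zero.2 (Or.inl (by simp [IsInexactStep, cgIterate, cgState, hg]))
  have hstep : P.step θ v H γ = 0 := by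
    rw [step, cgInexactStep, hcount]
    rfl
  simp [ratio, hstep]

theorem grad_ne_zero_of_not_isEpsPoint (hεg : 0 < εg) (hv : ¬ P.IsEpsPoint εR εg v) :
    P.grad v ≠ 0 :=
  fun hg => hv (Or.inr (by simpa [hg] using hεg.le))

theorem mul_Jhat_le_of_not_isEpsPoint (hεR : 0 < εR) (hεg : 0 < εg)
    (hv : ¬ P.IsEpsPoint εR εg v) : 2 * εg ^ 2 * P.Jhat v ≤ ‖P.grad v‖ ^ 2 := by
  rw [IsEpsPoint, not_or, not_le, not_le] at hv
  have hgrad := (lt_div_iff₀ (hεR.trans hv.1)).1 hv.2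
  calc 2 * εg ^ 2 * P.Jhat v = (εg * ‖P.Rhat v‖) ^ 2 := by rw [Jhat]; ring
    _ ≤ ‖P.grad v‖ ^ 2 := by gcongr

theorem lt_Jhat_of_not_isEpsPoint (hεR : 0 < εR) (hv : ¬ P.IsEpsPoint εR εg v) :
    εR ^ 2 / 2 < P.Jhat v := by
  rw [IsEpsPoint, not_or, not_le] at hv
  rw [Jhat]
  linarith [pow_lt_pow_left₀ hv.1 hεR.le two_ne_zero]

end ImplicitLS

/-- A parameter that is halved (but not below `γmin`) at the indices in `acc` and doubled at the
others, such as the regularization parameter of a run whose accepted iterations form `acc`. -/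
structure AdaptiveParameter (γmin : ℝ) (acc : Set ℕ) (γ : ℕ → ℝ) : Prop where
  min_pos : 0 < γmin
  min_le_zero : γmin ≤ γ 0
  accept : ∀ k ∈ acc, γ (k + 1) = max (0.5 * γ k) γmin
  reject : ∀ k ∉ acc, γ (k + 1) = 2 * γ k

namespace AdaptiveParameter

variable {γmin Λ : ℝ} {acc : Set ℕ} {γ : ℕ → ℝ}

theorem min_le (h : AdaptiveParameter γmin acc γ) (k : ℕ) : γmin ≤ γ k := by
  induction k with
  | zero => exact h.min_le_zero
  | succ k ih =>
    by_cases hk : k ∈ acc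
    · rw [h.accept k hk]
      exact le_max_right _ _
    · rw [h.reject k hk]
      linarith [h.min_pos]

theorem le_max (h : AdaptiveParameter γmin acc γ) {K : ℕ}
    (hacc : ∀ k < K, Λ ≤ γ k → k ∈ acc) : γ K ≤ max (γ 0) (2 * Λ) := by
  induction K with
  | zero => exact le_max_left _ _
  | succ k ih =>
    have hγk := ih fun i hi => hacc i (by omega)
    by_cases hk : k ∈ acc
    · rw [h.accept k hk]
      have hhalf : 0.5 * γ k ≤ γ k :=
        mul_le_of_le_one_left (h.min_pos.le.trans (h.min_le k)) (by norm_num)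
      exact max_le (hhalf.trans hγk) (h.min_le_zero.trans (le_max_left _ _))
    · rw [h.reject k hk]
      have hlt : γ k < Λ := lt_of_not_ge fun hΛ => hk (hacc k (by omega) hΛ)
      exact (by linarith : 2 * γ k ≤ 2 * Λ).trans (le_max_right _ _)

theorem two_pow_mul_le (h : AdaptiveParameter γmin acc γ) {k j : ℕ}
    (hrej : ∀ i < j, k + i ∉ acc) : 2 ^ j * γmin ≤ γ (k + j) := by
  induction j with
  | zero => simpa using h.min_le k
  | succ j ih =>
    rw [← add_assoc, h.reject _ (hrej j (by omega)), pow_succ]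
    linarith [ih fun i hi => hrej i (by omega)]

end AdaptiveParameter

section Counting

theorem finite_and_ncard_le_of_forall_card_le {α : Type*} {S : Set α} {B : ℝ}
    (hB : ∀ T : Finset α, ↑T ⊆ S → (T.card : ℝ) ≤ B) : S.Finite ∧ (S.ncard : ℝ) ≤ B := by
  have hfin : S.Finite := by
    by_contra hinf
    obtain ⟨T, hT, hcard⟩ := Set.Infinite.exists_subset_card_eq hinf (⌊B⌋₊ + 1)
    have hTB := hB T hT
    rw [hcard] at hTB
    push_cast at hTB
    exact (Nat.lt_floor_add_one B).not_ge hTB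
  refine ⟨hfin, ?_⟩
  rw [Set.ncard_eq_toFinset_card S hfin]
  exact hB _ (by simp)

variable {a : ℕ → ℝ} {S : Set ℕ} {c δ J : ℝ}

theorem le_exp_neg_mul_card_mul (ha : Antitone a) (hpos : ∀ k ∈ S, 0 < a k)
    (hS : ∀ k ∈ S, a (k + 1) ≤ (1 - c) * a k) {T : Finset ℕ} (hT : ↑T ⊆ S) :
    ∀ K, (∀ k ∈ T, k < K) → a K ≤ Real.exp (-(c * T.card)) * a 0 := by
  induction T using Finset.induction_on_max with
  | empty => exact fun K _ => by simpa using ha K.zero_le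
  | insert m T hm ih =>
    intro K hK
    rw [Finset.coe_insert, Set.insert_subset_iff] at hT
    have hmT : m ∉ T := fun hmem => (hm m hmem).false
    calc a K ≤ a (m + 1) := ha (hK m (Finset.mem_insert_self m T))
      _ ≤ (1 - c) * a m := hS m hT.1
      _ ≤ Real.exp (-c) * a m := by
        gcongr
        · exact (hpos m hT.1).le
        · exact Real.one_sub_le_exp_neg c
      _ ≤ Real.exp (-c) * (Real.exp (-(c * T.card)) * a 0) := by gcongr; exact ih hT.2 m hm
      _ = Real.exp (-(c * (insert m T).card)) * a 0 := by
        rw [← mul_assoc, ← Real.exp_add, Finset.card_insert_of_notMem hmT]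
        push_cast
        ring_nf

theorem finite_and_ncard_le_of_contraction (ha : Antitone a) (hJ : a 0 ≤ J) (hc : 0 < c)
    (hδ : 0 < δ) (hδS : ∀ k ∈ S, δ < a k) (hS : ∀ k ∈ S, a (k + 1) ≤ (1 - c) * a k) :
    S.Finite ∧ (S.ncard : ℝ) ≤ max 0 (Real.log (J / δ)) / c + 1 := by
  refine finite_and_ncard_le_of_forall_card_le fun T hT => ?_
  rcases T.eq_empty_or_nonempty with rfl | hne
  · rw [Finset.card_empty, Nat.cast_zero]
    positivity
  have hmax := T.max'_mem hne
  have hdecay : a (T.max' hne) ≤ Real.exp (-(c * (T.erase (T.max' hne)).card)) * a 0 :=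
    le_exp_neg_mul_card_mul ha (fun k hk => hδ.trans (hδS k hk)) hS
      ((Finset.coe_subset.2 (T.erase_subset _)).trans hT) _
      fun k hk => T.lt_max'_of_mem_erase_max' hne hk
  have hδJ : δ ≤ Real.exp (-(c * (T.erase (T.max' hne)).card)) * J :=
    (hδS _ (hT hmax)).le.trans (hdecay.trans (by gcongr))
  have hexp : Real.exp (c * (T.erase (T.max' hne)).card) ≤ J / δ := by
    rw [Real.exp_neg, ← div_eq_inv_mul, le_div_iff₀ (Real.exp_pos _)] at hδJ
    rwa [le_div_iff₀' hδ]
  have hlog : c * (T.erase (T.max' hne)).card ≤ Real.log (J / δ) :=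
    (Real.le_log_iff_exp_le ((Real.exp_pos _).trans_le hexp)).2 hexp
  rw [← Finset.card_erase_add_one hmax, Nat.cast_add_one]
  gcongr
  rw [le_div_iff₀' hc]
  exact hlog.trans (le_max_right _ _)

theorem ncard_le_mul_ncard_of_forall_exists_add_mem {U : Set ℕ} {b : ℕ} (hS : S.Finite)
    (h : ∀ k ∈ U, ∃ j ≤ b, k + j ∈ S) : U.Finite ∧ U.ncard ≤ (b + 1) * S.ncard := by
  have hsub : U ⊆ (fun z : ℕ × ℕ => z.2 - z.1) '' (Set.Iic b ×ˢ S) := fun k hk => by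
    obtain ⟨j, hj, hkj⟩ := h k hk
    exact ⟨(j, k + j), ⟨hj, hkj⟩, by simp⟩
  have hfin : (Set.Iic b ×ˢ S).Finite := (Set.finite_Iic b).prod hS
  refine ⟨(hfin.image _).subset hsub, ?_⟩
  calc U.ncard ≤ (Set.Iic b ×ˢ S).ncard :=
        (Set.ncard_le_ncard hsub (hfin.image _)).trans (Set.ncard_image_le hfin)
    _ = (b + 1) * S.ncard := by rw [Set.ncard_prod]; simp [Set.ncard_eq_toFinset_card']

theorem sum_le_mul_ncard {ι : Type*} {s : Finset ι} {S : Set ι} {f : ι → ℕ} {N : ℕ}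
    (hS : S.Finite) (hsub : ↑s ⊆ S) (hf : ∀ k ∈ s, f k ≤ N) : ∑ k ∈ s, f k ≤ N * S.ncard :=
  calc ∑ k ∈ s, f k ≤ s.card * N := by simpa using Finset.sum_le_card_nsmul s f N hf
    _ ≤ S.ncard * N := by
      gcongr
      rw [← Set.ncard_coe_finset]
      exact Set.ncard_le_ncard hsub hS
    _ = N * S.ncard := mul_comm _ _

end Counting

section ConditionNumber

variable {L MH η θ γ0 γmin : ℝ}

theorem div_le_kappaIn (hγmin : 0 < γmin) : (MH + γ0) / γmin ≤ kappaIn L MH η θ γ0 γmin := by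
  rw [kappaIn, gammaMaxIn]
  gcongr
  exact (le_max_left _ _).trans (le_max_right _ _)

theorem one_lt_add_div (hMH : 0 < MH) (hγmin : 0 < γmin) (hγ0 : γmin ≤ γ0) :
    1 < (MH + γ0) / γmin := by
  rw [one_lt_div hγmin]
  linarith

theorem one_lt_kappaIn (hMH : 0 < MH) (hγmin : 0 < γmin) (hγ0 : γmin ≤ γ0) :
    1 < kappaIn L MH η θ γ0 γmin :=
  (one_lt_add_div hMH hγmin hγ0).trans_le (div_le_kappaIn hγmin)

/- The quotient `(h + γ) / γ` decreases in `γ`, so its largest value is attained at `γmin`. -/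
theorem add_le_kappaIn_mul {γ h : ℝ} (hMH : 0 < MH) (hγmin : 0 < γmin) (hγ0 : γmin ≤ γ0)
    (hγ : γmin ≤ γ) (hh : h ≤ MH) : h + γ ≤ kappaIn L MH η θ γ0 γmin * γ :=
  calc h + γ ≤ (MH + γmin) / γmin * γ := by
        rw [add_div, div_self hγmin.ne', add_mul, one_mul, div_mul_eq_mul_div]
        gcongr
        rw [le_div_iff₀ hγmin]
        gcongr
    _ ≤ (MH + γ0) / γmin * γ := by gcongr; exact hγmin.le.trans hγ
    _ ≤ kappaIn L MH η θ γ0 γmin * γ := by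
        gcongr
        exacts [hγmin.le.trans hγ, div_le_kappaIn hγmin]

end ConditionNumber

namespace ImplicitLS

variable {ny n m p : ℕ} {P : ImplicitLS ny n m p} {L MH η θ γmin γ0 εR εg : ℝ} {u0 : Euc n}
  {H : ℕ → (Euc n →L[ℝ] Euc n)} {u : ℕ → Euc n} {γ : ℕ → ℝ} {k K : ℕ}

variable (P η θ H u γ) in
/-- The iterations that pass the sufficient decrease test. They turn out to be those with
`u (k + 1) ≠ u k`, see `IsAdmissibleRun.succ_ne_iff`. -/
def accepted : Set ℕ :=
  {k | η ≤ P.ratio (u k) (H k) (γ k) (P.step θ (u k) (H k) (γ k))}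

variable (P MH η θ γmin γ0 u0 H u γ) in
/-- A run of the regularization method whose parameters lie in the admissible ranges and whose
matrices are positive semidefinite and bounded by `MH`. -/
structure IsAdmissibleRun : Prop extends P.IsRun η θ γmin γ0 u0 H u γ where
  η_pos : 0 < η
  η_lt_one : η < 1
  θ_nonneg : 0 ≤ θ
  θ_lt_one : θ < 1
  γmin_pos : 0 < γmin
  γmin_le : γmin ≤ γ0
  isPositive : ∀ k, (H k).IsPositive
  norm_le : ∀ k, ‖H k‖ ≤ MH

variable (L MH η γ0) in
/-- An upper bound for `‖H k‖ + γ k` up to the first stationary iterate: once `γ k` reaches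
`L / (1 - η)` the step is accepted, so `γ` is never doubled beyond twice that value. -/
noncomputable def regularizedNormBound : ℝ := MH + max γ0 (2 * (L / (1 - η)))

theorem successes_union_failures :
    P.successes εR εg u ∪ P.failures εR εg u = {k | ¬ P.IsEpsPoint εR εg (u k)} := by
  ext k
  rw [Set.mem_union, successes, failures, Set.mem_ofPred_eq, Set.mem_ofPred_eq, Set.mem_ofPred_eq]
  tauto

theorem exists_first_isEpsPoint (hS : (P.successes εR εg u).Finite)
    (hU : (P.failures εR εg u).Finite) :
    ∃ K : ℕ, P.IsEpsPoint εR εg (u K) ∧ ∀ k < K, ¬ P.IsEpsPoint εR εg (u k) := by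
  classical
  have hex : ∃ K : ℕ, P.IsEpsPoint εR εg (u K) := by
    by_contra! hno
    have hfin : {k | ¬ P.IsEpsPoint εR εg (u k)}.Finite :=
      successes_union_failures ▸ hS.union hU
    exact Set.infinite_univ (α := ℕ) (hfin.subset fun k _ => hno k)
  exact ⟨Nat.find hex, Nat.find_spec hex, fun k hk => Nat.find_min hex hk⟩

namespace IsAdmissibleRun

variable (h : P.IsAdmissibleRun MH η θ γmin γ0 u0 H u γ)
include h

theorem adaptiveParameter : AdaptiveParameter γmin (P.accepted η θ H u γ) γ where
  min_pos := h.γmin_pos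
  min_le_zero := h.γ_zero ▸ h.γmin_le
  accept k hk := (h.accept k hk).2
  reject k hk := (h.reject k hk).2

theorem min_le_γ (k : ℕ) : γmin ≤ γ k := h.adaptiveParameter.min_le k

theorem γ_pos (k : ℕ) : 0 < γ k := h.γmin_pos.trans_le (h.min_le_γ k)

theorem grad_ne_zero_of_mem_accepted (hk : k ∈ P.accepted η θ H u γ) : P.grad (u k) ≠ 0 :=
  fun hg => h.η_pos.not_ge (hk.trans_eq (ratio_step_eq_zero _ _ _ hg))

theorem succ_ne_iff : u (k + 1) ≠ u k ↔ k ∈ P.accepted η θ H u γ := by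
  refine ⟨fun hne => by_contra fun hk => hne (h.reject k hk).1, fun hk => ?_⟩
  rw [(h.accept k hk).1, Ne, add_eq_left]
  exact step_ne_zero (h.isPositive k) (h.γ_pos k) h.θ_nonneg h.θ_lt_one
    (h.grad_ne_zero_of_mem_accepted hk)

theorem grad_ne_zero_of_le (hkK : k ≤ K) (hK : P.grad (u K) ≠ 0) : P.grad (u k) ≠ 0 := by
  contrapose! hK
  induction K, hkK using Nat.le_induction with
  | base => exact hK
  | succ i _ ih =>
    have hi : i ∉ P.accepted η θ H u γ := fun hacc => h.grad_ne_zero_of_mem_accepted hacc ih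
    rwa [(h.reject i hi).1]

theorem mem_accepted_of_le (hP : P.WellPosed) (hL : P.LipschitzGradient L)
    (hLγ : L / (1 - η) ≤ γ k) (hg : P.grad (u k) ≠ 0) : k ∈ P.accepted η θ H u γ :=
  hP.le_ratio hL (h.isPositive k) h.η_lt_one (h.γ_pos k) hLγ h.θ_nonneg h.θ_lt_one hg

theorem norm_add_le_regularizedNormBound (hP : P.WellPosed) (hL : P.LipschitzGradient L)
    (hg : P.grad (u k) ≠ 0) : ‖H k‖ + γ k ≤ regularizedNormBound L MH η γ0 := by
  refine add_le_add (h.norm_le k) (h.γ_zero ▸ ?_)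
  exact h.adaptiveParameter.le_max fun i hi hLγ =>
    h.mem_accepted_of_le hP hL hLγ (h.grad_ne_zero_of_le hi.le hg)

theorem regularizedNormBound_pos : 0 < regularizedNormBound L MH η γ0 :=
  add_pos_of_nonneg_of_pos ((norm_nonneg _).trans (h.norm_le 0))
    (lt_max_of_lt_left (h.γmin_pos.trans_le h.γmin_le))

theorem one_sub_sq_pos : 0 < 1 - θ ^ 2 :=
  sub_pos.2 (pow_lt_one₀ h.θ_nonneg h.θ_lt_one two_ne_zero)

theorem Jhat_succ_le_of_mem_accepted (hk : k ∈ P.accepted η θ H u γ) :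
    P.Jhat (u (k + 1)) ≤
      P.Jhat (u k) - η * ((1 - θ ^ 2) * ‖P.grad (u k)‖ ^ 2 / (2 * (‖H k‖ + γ k))) := by
  have hpred := predicted_decrease_pos (h.isPositive k) (h.γ_pos k) h.θ_nonneg h.θ_lt_one
    (h.grad_ne_zero_of_mem_accepted hk)
  have hactual := (le_div_iff₀ hpred).1 hk
  have hlow := mul_le_mul_of_nonneg_left
    (le_predicted_decrease (P := P) (h.isPositive k) (h.γ_pos k) h.θ_nonneg (u k)) h.η_pos.le
  rw [(h.accept k hk).1]
  linarith

theorem antitone_Jhat : Antitone fun k => P.Jhat (u k) := by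
  refine antitone_nat_of_succ_le fun k => ?_
  by_cases hk : k ∈ P.accepted η θ H u γ
  · have hγk := h.γ_pos k
    have hθ := h.one_sub_sq_pos
    have hη := h.η_pos
    exact (h.Jhat_succ_le_of_mem_accepted hk).trans (sub_le_self _ (by positivity))
  · rw [(h.reject k hk).1]

theorem Jhat_succ_le_mul_of_mem_successes (hP : P.WellPosed) (hL : P.LipschitzGradient L)
    (hεR : 0 < εR) (hεg : 0 < εg) (hk : k ∈ P.successes εR εg u) :
    P.Jhat (u (k + 1)) ≤
      (1 - η * (1 - θ ^ 2) * εg ^ 2 / regularizedNormBound L MH η γ0) * P.Jhat (u k) := by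
  have hγk := h.γ_pos k
  have hθ := h.one_sub_sq_pos
  have hη := h.η_pos
  have hD := h.norm_add_le_regularizedNormBound hP hL (grad_ne_zero_of_not_isEpsPoint hεg hk.2)
  have hgrad := mul_Jhat_le_of_not_isEpsPoint hεR hεg hk.2
  calc P.Jhat (u (k + 1))
      ≤ P.Jhat (u k) - η * ((1 - θ ^ 2) * ‖P.grad (u k)‖ ^ 2 / (2 * (‖H k‖ + γ k))) :=
        h.Jhat_succ_le_of_mem_accepted (h.succ_ne_iff.1 hk.1)
    _ ≤ P.Jhat (u k) - η * ((1 - θ ^ 2) * (2 * εg ^ 2 * P.Jhat (u k)) /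
          (2 * regularizedNormBound L MH η γ0)) := by gcongr
    _ = _ := by
      have hD0 := h.regularizedNormBound_pos (L := L)
      field_simp

theorem finite_successes_and_ncard_le (hP : P.WellPosed) (hL : P.LipschitzGradient L)
    (hεR : 0 < εR) (hεg : 0 < εg) {J : ℝ} (hJ : P.Jhat u0 ≤ J) :
    (P.successes εR εg u).Finite ∧ ((P.successes εR εg u).ncard : ℝ) ≤
      max 0 (Real.log (J / (εR ^ 2 / 2))) /
        (η * (1 - θ ^ 2) * εg ^ 2 / regularizedNormBound L MH η γ0) + 1 := by
  have hθ := h.one_sub_sq_pos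
  have hη := h.η_pos
  have hD := h.regularizedNormBound_pos (L := L)
  exact finite_and_ncard_le_of_contraction h.antitone_Jhat (by rwa [h.u_zero]) (by positivity)
    (by positivity) (fun k hk => lt_Jhat_of_not_isEpsPoint hεR hk.2)
    fun k hk => h.Jhat_succ_le_mul_of_mem_successes hP hL hεR hεg hk

theorem eq_of_forall_notMem_accepted {j : ℕ} (hrej : ∀ i < j, k + i ∉ P.accepted η θ H u γ) :
    u (k + j) = u k := by
  induction j with
  | zero => rfl
  | succ j ih =>
    rw [← add_assoc, (h.reject _ (hrej j j.lt_succ_self)).1]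
    exact ih fun i hi => hrej i (hi.trans j.lt_succ_self)

theorem exists_add_mem_successes (hP : P.WellPosed) (hL : P.LipschitzGradient L) (hεg : 0 < εg)
    {b : ℕ} (hb : L / (1 - η) ≤ 2 ^ b * γmin) (hk : ¬ P.IsEpsPoint εR εg (u k)) :
    ∃ j ≤ b, k + j ∈ P.successes εR εg u := by
  classical
  have hex : ∃ j, j ≤ b ∧ k + j ∈ P.accepted η θ H u γ := by
    by_contra! hno
    have hrej : ∀ i < b, k + i ∉ P.accepted η θ H u γ := fun i hi => hno i hi.le
    refine hno b le_rfl (h.mem_accepted_of_le hP hL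
      (hb.trans (h.adaptiveParameter.two_pow_mul_le hrej)) ?_)
    rw [h.eq_of_forall_notMem_accepted hrej]
    exact grad_ne_zero_of_not_isEpsPoint hεg hk
  obtain ⟨hj, hacc⟩ := Nat.find_spec hex
  have hrej : ∀ i < Nat.find hex, k + i ∉ P.accepted η θ H u γ := fun i hi hi' =>
    Nat.find_min hex hi ⟨hi.le.trans hj, hi'⟩
  exact ⟨Nat.find hex, hj, h.succ_ne_iff.2 hacc, by rwa [h.eq_of_forall_notMem_accepted hrej]⟩

theorem finite_failures_and_ncard_le (hP : P.WellPosed) (hL : P.LipschitzGradient L)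
    (hεg : 0 < εg) {b : ℕ} (hb : L / (1 - η) ≤ 2 ^ b * γmin)
    (hS : (P.successes εR εg u).Finite) :
    (P.failures εR εg u).Finite ∧
      (P.failures εR εg u).ncard ≤ (b + 1) * (P.successes εR εg u).ncard :=
  ncard_le_mul_ncard_of_forall_exists_add_mem hS fun _ hk =>
    h.exists_add_mem_successes hP hL hεg hb hk.2

theorem products_le_cgBound (hMH : 0 < MH) (L : ℝ) (k : ℕ) :
    P.products θ H u γ k ≤ cgBound n (kappaIn L MH η θ γ0 γmin) θ := by
  have hcount := cgCount_le_cgBound (h.isPositive k) (h.γ_pos k)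
    (one_lt_kappaIn (L := L) (η := η) (θ := θ) hMH h.γmin_pos h.γmin_le)
    (add_le_kappaIn_mul hMH h.γmin_pos h.γmin_le (h.min_le_γ k) (h.norm_le k)) h.θ_nonneg
    (P.grad (u k))
  rwa [finrank_euclideanSpace_fin] at hcount

theorem sum_products_successful_le (hMH : 0 < MH) (L : ℝ) (hS : (P.successes εR εg u).Finite)
    (hK : ∀ k < K, ¬ P.IsEpsPoint εR εg (u k)) :
    ∑ k ∈ (Finset.range K).filter (fun k => u (k + 1) ≠ u k), P.products θ H u γ k ≤
      cgBound n (kappaIn L MH η θ γ0 γmin) θ * (P.successes εR εg u).ncard := by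
  refine sum_le_mul_ncard hS (fun k hk => ?_) fun k _ => h.products_le_cgBound hMH L k
  obtain ⟨hkK, hne⟩ := Finset.mem_filter.1 hk
  exact ⟨hne, hK k (Finset.mem_range.1 hkK)⟩

theorem sum_products_le (hMH : 0 < MH) (L : ℝ) (hS : (P.successes εR εg u).Finite)
    (hU : (P.failures εR εg u).Finite) (hK : ∀ k < K, ¬ P.IsEpsPoint εR εg (u k)) :
    ∑ k ∈ Finset.range K, P.products θ H u γ k ≤ cgBound n (kappaIn L MH η θ γ0 γmin) θ *
      ((P.successes εR εg u).ncard + (P.failures εR εg u).ncard) :=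
  calc _ ≤ cgBound n (kappaIn L MH η θ γ0 γmin) θ *
          (P.successes εR εg u ∪ P.failures εR εg u).ncard :=
        sum_le_mul_ncard (hS.union hU)
          (fun k hk => successes_union_failures.ge (hK k (Finset.mem_range.1 hk)))
          fun k _ => h.products_le_cgBound hMH L k
    _ ≤ _ := by gcongr; exact Set.ncard_union_le _ _

end IsAdmissibleRun

end ImplicitLS

section Rates

theorem cgBound_le {κ₀ κ θ : ℝ} (n : ℕ) (hκ₀ : 1 < κ₀) (hκ : κ₀ ≤ κ) (hθ : 0 < θ)
    (hθ1 : θ < 1) : (cgBound n κ θ : ℝ) ≤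
      (1 + 3 / (2 * Real.log κ₀)) * min (n : ℝ) (√κ * Real.log (κ / θ)) := by
  have hκpos : 0 < κ := by linarith
  have hlog₀ : 0 < Real.log κ₀ := Real.log_pos hκ₀
  have hsqrt : 1 ≤ √κ := Real.one_le_sqrt.2 (hκ₀.le.trans hκ)
  have hlog : Real.log κ₀ ≤ Real.log (κ / θ) :=
    Real.log_le_log (by linarith) (hκ.trans (le_div_self hκpos.le hθ hθ1.le))
  have hlog_two_mul : Real.log (2 * κ / θ) ≤ 1 + Real.log (κ / θ) := by
    rw [mul_div_assoc, Real.log_mul two_ne_zero (by positivity)]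
    linarith [Real.log_two_lt_d9]
  have hlog_pos : 0 ≤ Real.log (2 * κ / θ) :=
    Real.log_nonneg ((one_le_div hθ).2 (by linarith))
  have hceil : (⌈1 / 2 * √κ * Real.log (2 * κ / θ)⌉₊ : ℝ) ≤
      (1 + 3 / (2 * Real.log κ₀)) * (√κ * Real.log (κ / θ)) :=
    calc (⌈1 / 2 * √κ * Real.log (2 * κ / θ)⌉₊ : ℝ)
        ≤ 1 / 2 * √κ * Real.log (2 * κ / θ) + 1 := (Nat.ceil_lt_add_one (by positivity)).le
      _ ≤ 1 / 2 * √κ * (1 + Real.log (κ / θ)) + √κ := by gcongr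
      _ = √κ * (1 / 2 * Real.log (κ / θ) + 3 / (2 * Real.log κ₀) * Real.log κ₀) := by
        field_simp
        ring
      _ ≤ √κ * (1 * Real.log (κ / θ) + 3 / (2 * Real.log κ₀) * Real.log (κ / θ)) := by
        gcongr
        · exact hlog₀.le.trans hlog
        · norm_num
      _ = _ := by ring
  have hC : 1 ≤ 1 + 3 / (2 * Real.log κ₀) := le_add_of_nonneg_right (by positivity)
  rw [cgBound, if_neg hθ.ne', Nat.cast_min, mul_min_of_nonneg _ _ (by positivity)]
  exact min_le_min (le_mul_of_one_le_left n.cast_nonneg hC) hceil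

theorem one_div_le_log_mul_one_div_sq {x x₀ : ℝ} (hx : 0 < x) (hxx₀ : x ≤ x₀) (hx₀ : x₀ < 1) :
    1 / x ≤ 1 / Real.log (1 / x₀) * (Real.log (1 / x) * (1 / x ^ 2)) := by
  have hx₀pos : 0 < x₀ := hx.trans_le hxx₀
  have hlog₀ : 0 < Real.log (1 / x₀) := Real.log_pos ((one_lt_div hx₀pos).2 hx₀)
  have hlog : Real.log (1 / x₀) ≤ Real.log (1 / x) := by gcongr
  have hlog_nonneg : 0 ≤ Real.log (1 / x) := hlog₀.le.trans hlog
  rw [one_div_mul_eq_div, le_div_iff₀ hlog₀, mul_comm]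
  gcongr
  exact pow_le_of_le_one hx.le (hxx₀.trans hx₀.le) two_ne_zero

variable {ε εbar J : ℝ}

theorem one_le_log_inv_div (hε : 0 < ε) (hεεbar : ε ≤ εbar) (hεbar1 : εbar < 1) :
    1 ≤ Real.log ε⁻¹ / Real.log εbar⁻¹ := by
  have hεbar : 0 < εbar := hε.trans_le hεεbar
  rw [one_le_div (Real.log_pos ((one_lt_inv₀ hεbar).2 hεbar1))]
  gcongr

theorem max_zero_log_div_le (hJ : 1 ≤ J) (hε : 0 < ε) (hεεbar : ε ≤ εbar) (hεbar1 : εbar < 1) :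
    max 0 (Real.log (J / (ε ^ 2 / 2))) ≤
      (Real.log (2 * J) / Real.log εbar⁻¹ + 2) * Real.log ε⁻¹ := by
  have hlogJ : 0 ≤ Real.log (2 * J) := Real.log_nonneg (by linarith)
  have hlogε : 0 < Real.log ε⁻¹ := Real.log_pos ((one_lt_inv₀ hε).2 (hεεbar.trans_lt hεbar1))
  have hsplit : Real.log (J / (ε ^ 2 / 2)) = Real.log (2 * J) + 2 * Real.log ε⁻¹ := by
    rw [show J / (ε ^ 2 / 2) = 2 * J * ε⁻¹ ^ 2 by field_simp,
      Real.log_mul (by positivity) (by positivity), Real.log_pow, Nat.cast_ofNat]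
  rw [hsplit, max_eq_right (by positivity), add_mul, div_mul_eq_mul_div, mul_div_assoc]
  gcongr
  exact le_mul_of_one_le_right hlogJ (one_le_log_inv_div hε hεεbar hεbar1)

end Rates

namespace ImplicitLS

namespace IsAdmissibleRun

variable {ny n m p : ℕ} {P : ImplicitLS ny n m p} {L MH η θ γmin γ0 εR εg εbar J : ℝ}
  {u0 : Euc n} {H : ℕ → (Euc n →L[ℝ] Euc n)} {u : ℕ → Euc n} {γ : ℕ → ℝ}

variable (h : P.IsAdmissibleRun MH η θ γmin γ0 u0 H u γ)
include h

theorem one_le_log_inv_mul_rate (hεR : 0 < εR) (hεRbar : εR ≤ εbar) (hεbar1 : εbar < 1)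
    (hεg : 0 < εg) (hεg1 : εg < 1) :
    1 ≤ 1 / Real.log εbar⁻¹ * (1 / (1 - θ ^ 2) * Real.log εR⁻¹ * (1 / εg ^ 2)) := by
  have hθ : 1 ≤ 1 / (1 - θ ^ 2) :=
    (one_le_div h.one_sub_sq_pos).2 (sub_le_self _ (sq_nonneg θ))
  have hεg2 : 1 ≤ 1 / εg ^ 2 := (one_le_div (by positivity)).2 (pow_le_one₀ hεg.le hεg1.le)
  calc (1 : ℝ) ≤ Real.log εR⁻¹ / Real.log εbar⁻¹ * (1 / (1 - θ ^ 2) * (1 / εg ^ 2)) :=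
        one_le_mul_of_one_le_of_one_le (one_le_log_inv_div hεR hεRbar hεbar1)
          (one_le_mul_of_one_le_of_one_le hθ hεg2)
    _ = _ := by ring

theorem ncard_successes_le (hP : P.WellPosed) (hL : P.LipschitzGradient L) (hJ : P.Jhat u0 ≤ J)
    (hJ1 : 1 ≤ J) (hεR : 0 < εR) (hεRbar : εR ≤ εbar) (hεbar1 : εbar < 1) (hεg : 0 < εg)
    (hεg1 : εg < 1) : ((P.successes εR εg u).ncard : ℝ) ≤
      ((Real.log (2 * J) / Real.log εbar⁻¹ + 2) * (regularizedNormBound L MH η γ0 / η) +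
        1 / Real.log εbar⁻¹) * (1 / (1 - θ ^ 2) * Real.log εR⁻¹ * (1 / εg ^ 2)) := by
  have hθ := h.one_sub_sq_pos
  have hη := h.η_pos
  have hD := h.regularizedNormBound_pos (L := L)
  rw [add_mul]
  refine (h.finite_successes_and_ncard_le hP hL hεR hεg hJ).2.trans (add_le_add ?_
    (h.one_le_log_inv_mul_rate hεR hεRbar hεbar1 hεg hεg1))
  calc _ ≤ (Real.log (2 * J) / Real.log εbar⁻¹ + 2) * Real.log εR⁻¹ /
          (η * (1 - θ ^ 2) * εg ^ 2 / regularizedNormBound L MH η γ0) := by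
        gcongr
        exact max_zero_log_div_le hJ1 hεR hεRbar hεbar1
    _ = _ := by
      simp only [div_eq_mul_inv, mul_inv, inv_inv]
      ring

theorem one_add_ncard_add_ncard_le (hP : P.WellPosed) (hL : P.LipschitzGradient L)
    (hJ : P.Jhat u0 ≤ J) (hJ1 : 1 ≤ J) {b : ℕ} (hb : L / (1 - η) ≤ 2 ^ b * γmin) (hεR : 0 < εR)
    (hεRbar : εR ≤ εbar) (hεbar1 : εbar < 1) (hεg : 0 < εg) (hεg1 : εg < 1) :
    1 + ((P.successes εR εg u).ncard : ℝ) + (P.failures εR εg u).ncard ≤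
      (1 / Real.log εbar⁻¹ + (b + 2) *
        ((Real.log (2 * J) / Real.log εbar⁻¹ + 2) * (regularizedNormBound L MH η γ0 / η) +
          1 / Real.log εbar⁻¹)) * (1 / (1 - θ ^ 2) * Real.log εR⁻¹ * (1 / εg ^ 2)) := by
  have hfin := (h.finite_successes_and_ncard_le hP hL hεR hεg hJ).1
  have hfailures : ((P.failures εR εg u).ncard : ℝ) ≤ (b + 1) * (P.successes εR εg u).ncard :=
    mod_cast (h.finite_failures_and_ncard_le hP hL hεg hb hfin).2
  calc 1 + ((P.successes εR εg u).ncard : ℝ) + (P.failures εR εg u).ncard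
      ≤ 1 + (b + 2) * (P.successes εR εg u).ncard := by linarith
    _ ≤ _ := by
      rw [add_mul (1 / Real.log εbar⁻¹), mul_assoc ((b : ℝ) + 2)]
      gcongr
      · exact h.one_le_log_inv_mul_rate hεR hεRbar hεbar1 hεg hεg1
      · exact h.ncard_successes_le hP hL hJ hJ1 hεR hεRbar hεbar1 hεg hεg1

end IsAdmissibleRun

theorem exists_forall_one_add_ncard_le (L MH η γ0 J0 : ℝ) {γmin θ₀ εbar : ℝ} (hγmin : 0 < γmin)
    (hθ₀ : 0 < θ₀) (hθ₀1 : θ₀ < 1) (hεbar1 : εbar < 1) :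
    ∃ C : ℝ, 0 < C ∧
      ∀ {ny n m p : ℕ} {P : ImplicitLS ny n m p} {u0 : Euc n} {θ εR εg : ℝ}
        {H : ℕ → (Euc n →L[ℝ] Euc n)} {u : ℕ → Euc n} {γ : ℕ → ℝ},
        P.IsAdmissibleRun MH η θ γmin γ0 u0 H u γ → P.WellPosed → P.LipschitzGradient L →
        P.Jhat u0 ≤ J0 → θ₀ ≤ θ → 0 < εR → εR ≤ εbar → 0 < εg → εg < 1 →
        1 + ((P.successes εR εg u).ncard : ℝ) + (P.failures εR εg u).ncard ≤
          C * (Real.log (1 / (1 - θ ^ 2)) * (1 / (1 - θ ^ 2) ^ 2) * Real.log εR⁻¹ *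
            (1 / εg ^ 2)) := by
  obtain ⟨b, hb⟩ := pow_unbounded_of_one_lt (L / (1 - η) / γmin) (one_lt_two (α := ℝ))
  set C : ℝ := 1 / Real.log εbar⁻¹ + (b + 2) * ((Real.log (2 * max 1 J0) / Real.log εbar⁻¹ + 2) *
    (regularizedNormBound L MH η γ0 / η) + 1 / Real.log εbar⁻¹)
  have hlog₀ : 0 < Real.log (1 / (1 - θ₀ ^ 2)) :=
    Real.log_pos ((one_lt_div (by nlinarith)).2 (by nlinarith))
  refine ⟨max 1 C * (1 / Real.log (1 / (1 - θ₀ ^ 2))), by positivity, ?_⟩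
  intro ny n m p P u0 θ εR εg H u γ h hP hL hJ hθ hεR hεRbar hεg hεg1
  have hlogεR : 0 < Real.log εR⁻¹ := Real.log_pos ((one_lt_inv₀ hεR).2 (hεRbar.trans_lt hεbar1))
  have hrate : 1 / (1 - θ ^ 2) ≤ 1 / Real.log (1 / (1 - θ₀ ^ 2)) *
      (Real.log (1 / (1 - θ ^ 2)) * (1 / (1 - θ ^ 2) ^ 2)) :=
    one_div_le_log_mul_one_div_sq h.one_sub_sq_pos (by gcongr) (by nlinarith)
  have hθ_nonneg : 0 ≤ 1 / (1 - θ ^ 2) := (one_div_pos.2 h.one_sub_sq_pos).le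
  calc 1 + ((P.successes εR εg u).ncard : ℝ) + (P.failures εR εg u).ncard
      ≤ C * (1 / (1 - θ ^ 2) * Real.log εR⁻¹ * (1 / εg ^ 2)) :=
        h.one_add_ncard_add_ncard_le hP hL (hJ.trans (le_max_right _ _)) (le_max_left _ _)
          ((div_lt_iff₀ hγmin).1 hb).le hεR hεRbar hεbar1 hεg hεg1
    _ ≤ max 1 C * (1 / Real.log (1 / (1 - θ₀ ^ 2)) *
          (Real.log (1 / (1 - θ ^ 2)) * (1 / (1 - θ ^ 2) ^ 2)) * Real.log εR⁻¹ * (1 / εg ^ 2)) := by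
        gcongr
        exact le_max_right _ _
    _ = _ := by ring

end ImplicitLS

theorem corollary3
    (L MH η γ0 γmin J0 θ₀ εbar : ℝ)
    (hL : 0 < L) (hMH : 0 < MH) (hη : 0 < η) (hη1 : η < 1)
    (hγmin : 0 < γmin) (hγ0 : γmin ≤ γ0)
    (hθ₀ : 0 < θ₀) (hθ₀1 : θ₀ < 1) (hεbar : 0 < εbar) (hεbar1 : εbar < 1) :
    ∃ C : ℝ, 0 < C ∧
      ∀ (ny n m p : ℕ) (P : ImplicitLS ny n m p) (u0 : Euc n) (θ εR εg : ℝ)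
        (H : ℕ → (Euc n →L[ℝ] Euc n)) (u : ℕ → Euc n) (γ : ℕ → ℝ),
        P.WellPosed → P.LipschitzGradient L → P.Jhat u0 ≤ J0 →
        0 ≤ θ → θ < 1 → 0 < εR → 0 < εg → εg < 1 →
        (∀ k, ‖H k‖ ≤ MH) → (∀ k, (H k).IsPositive) →
        P.IsRun η θ γmin γ0 u0 H u γ →
        (P.successes εR εg u).Finite ∧ (P.failures εR εg u).Finite ∧
        (∃ K : ℕ,
          P.IsEpsPoint εR εg (u K) ∧ (∀ k < K, ¬ P.IsEpsPoint εR εg (u k)) ∧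
          (∀ k < K, IsInexactStep θ (γ k) (H k) (P.grad (u k))
              (P.step θ (u k) (H k) (γ k)) ∧
            P.products θ H u γ k ≤ cgBound n (kappaIn L MH η θ γ0 γmin) θ) ∧
          (∑ k ∈ (Finset.range K).filter (fun k => u (k + 1) ≠ u k), P.products θ H u γ k ≤
            cgBound n (kappaIn L MH η θ γ0 γmin) θ *
              (1 + (P.successes εR εg u).ncard)) ∧
          (∑ k ∈ Finset.range K, P.products θ H u γ k ≤
            cgBound n (kappaIn L MH η θ γ0 γmin) θ *
              (1 + (P.successes εR εg u).ncard + (P.failures εR εg u).ncard))) ∧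
        (θ₀ ≤ θ → εR ≤ εbar →
          ((cgBound n (kappaIn L MH η θ γ0 γmin) θ *
              (1 + (P.successes εR εg u).ncard + (P.failures εR εg u).ncard) : ℕ) : ℝ) ≤
            C * (min (n : ℝ) (√(kappaIn L MH η θ γ0 γmin) *
                Real.log (kappaIn L MH η θ γ0 γmin / θ)) *
              Real.log (1 / (1 - θ ^ 2)) * (1 / (1 - θ ^ 2) ^ 2) *
              Real.log (εR⁻¹) * (1 / εg ^ 2))) := by
  have hκ₀ : 1 < (MH + γ0) / γmin := one_lt_add_div hMH hγmin hγ0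
  obtain ⟨C, hC, hiter⟩ :=
    ImplicitLS.exists_forall_one_add_ncard_le L MH η γ0 J0 hγmin hθ₀ hθ₀1 hεbar1
  have hlog₀ := Real.log_pos hκ₀
  refine ⟨(1 + 3 / (2 * Real.log ((MH + γ0) / γmin))) * C, by positivity, ?_⟩
  intro ny n m p P u0 θ εR εg H u γ hP hLip hJ hθ hθ1 hεR hεg hεg1 hHle hHpos hrun
  have h : P.IsAdmissibleRun MH η θ γmin γ0 u0 H u γ :=
    ⟨hrun, hη, hη1, hθ, hθ1, hγmin, hγ0, hHpos, hHle⟩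
  obtain ⟨b, hb⟩ := pow_unbounded_of_one_lt (L / (1 - η) / γmin) (one_lt_two (α := ℝ))
  have hS := (h.finite_successes_and_ncard_le hP hLip hεR hεg hJ).1
  have hU := (h.finite_failures_and_ncard_le hP hLip hεg ((div_lt_iff₀ hγmin).1 hb).le hS).1
  obtain ⟨K, hK, hKmin⟩ := ImplicitLS.exists_first_isEpsPoint hS hU
  refine ⟨hS, hU, ⟨K, hK, hKmin, fun k _ => ⟨?_, h.products_le_cgBound hMH L k⟩, ?_, ?_⟩, ?_⟩
  · exact isInexactStep_cgInexactStep (hHpos k) (h.γ_pos k) hθ _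
  · exact (h.sum_products_successful_le hMH L hS hKmin).trans (Nat.mul_le_mul_left _ (by omega))
  · exact (h.sum_products_le hMH L hS hU hKmin).trans (Nat.mul_le_mul_left _ (by omega))
  · intro hθ₀θ hεRbar
    have hcg := cgBound_le n hκ₀ (div_le_kappaIn (L := L) (η := η) (θ := θ) hγmin)
      (hθ₀.trans_le hθ₀θ) hθ1
    push_cast
    refine (mul_le_mul hcg (hiter h hP hLip hJ hθ₀θ hεR hεRbar hεg hεg1) (by positivity)
      ((Nat.cast_nonneg _).trans hcg)).trans_eq ?_
    ring
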